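/- Let $\mathbb S^1=\mathbb R/2\pi\mathbb Z$. An *$H^{1/2}$-framed loop* is a pair $(\gamma,\mathcal N)$ with $\gamma\in H^{3/2}(\mathbb S^1;\mathbb R^3)$, $0<c\le|\gamma'|\le C$ almost everywhere for some constants $c,C$, with $\mathcal N\in H^{1/2}(\mathbb S^1;\mathbb R^3)$, $|\mathcal N|=1$ almost everywhere, and $\gamma'\perp\mathcal N$ almost everywhere. Put $$\operatorname{Length}(\gamma)=\int_{\mathbb S^1}|\gamma'|\,d\varphi ,\qquad \int_{\mathbb S^1}|D_s\mathcal N|\,d\ell=\int_{\mathbb S^1}\frac{|\mathcal N'|}{|\gamma'|}\,|\gamma'|\,d\varphi\in[0,\infty],$$ where the second quantity is $+\infty$ if $\mathcal N\notin W^{1,1}(\mathbb S^1;\mathbb R^3)$. Fix a base point $\varphi_0$. A bounded measurable field $X:(\varphi_0,\varphi_0+2\pi)\to\mathbb R^3$ with $X\perp\mathcal N$ almost everywhere is *parallel* if $X'=\langle X',\mathcal N\rangle\mathcal N$, in the sense that $$\lim_{h\downarrow0}\int_{\varphi_0}^{\varphi_0+2\pi-h}\bigl|P_{\mathcal N(\varphi)}\,\tfrac{X(\varphi+h)-X(\varphi)}{h}\bigr|\,d\varphi=0,\qquad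 P_nv=v-\langle v,n\rangle n .$$ (If $\mathcal N$ is smooth, or only in $W^{1,1}$, these are, up to null sets, the absolutely continuous fields $X\perp\mathcal N$ with $X'=\langle X',\mathcal N\rangle\mathcal N$ almost everywhere.) Let $E_1,E_2$ be parallel fields that are orthonormal almost everywhere and have values $e_1,e_2$ at $\varphi_0$ in the sense that $\frac1\varepsilon\int_{\varphi_0}^{\varphi_0+\varepsilon}|E_i-e_i|\,d\varphi\to0$ as $\varepsilon\downarrow0$. They give the parallel transport $\Pi_{\varphi,\varphi_0}v=\sum_{i}\langle v,E_i(\varphi)\rangle e_i$ of vectors $v\perp\mathcal N(\varphi)$ from $\varphi\in(\varphi_0,\varphi_0+2\pi)$ down to $\varphi_0$. A vector $B\in\mathbb R^3$ is a *Burgers vector* of $(\gamma,\mathcal N)$ relative to $\varphi_0$ if, for some such $E_i,e_i$, $$B=\int_{\varphi_0}^{\varphi_0+2\pi}\Pi_{\varphi,\varphi_0}\gamma'(\varphi)\,d\varphi .$$ **Theorem.** Let $(\gamma,\mathcal N)$ be an $H^{1/2}$-framed loop (with no topological condition) and let $\varphi_0$ be any base point. If $\int_{\mathbb S^1}|D_s\mathcal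 N|\,d\ell<\infty$, then there is exactly one Burgers vector $B_{\gamma,\mathcal N,\varphi_0}$ relative to $\varphi_0$. In all cases, every Burgers vector $B_{\gamma,\mathcal N,\varphi_0}$ relative to $\varphi_0$ satisfies $$\int_{\mathbb S^1}|D_s\mathcal N|\,d\ell\ \ge\ \frac{|B_{\gamma,\mathcal N,\varphi_0}|}{\operatorname{Length}(\gamma)} .$$ -/

import Mathlib

open MeasureTheory Set Filter Topology
open scoped ENNReal ContDiff

namespace FramedLoop

/-- Euclidean three-space. Maps on the circle `𝕊¹ = ℝ / 2πℤ` are written as `2π`-periodic maps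
on `ℝ`; Sobolev maps are only determined almost everywhere. -/
abbrev E3 : Type := EuclideanSpace ℝ (Fin 3)

/-- `g ∈ L¹(𝕊¹)` is the weak derivative of `f ∈ L¹(𝕊¹)`; equivalently `f ∈ W^{1,1}(𝕊¹; ℝ³)` with
`f' = g`. The test functions are the smooth functions on the circle. -/
structure HasWeakDeriv (f g : ℝ → E3) : Prop where
  periodic_fun : Function.Periodic f (2 * Real.pi)
  periodic_deriv : Function.Periodic g (2 * Real.pi)
  integrable_fun : IntegrableOn f (Ioc 0 (2 * Real.pi))
  integrable_deriv : IntegrableOn g (Ioc 0 (2 * Real.pi))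
  integral_test : ∀ ψ : ℝ → ℝ, ContDiff ℝ ∞ ψ → Function.Periodic ψ (2 * Real.pi) →
    ∫ x in Ioc 0 (2 * Real.pi), deriv ψ x • f x = - ∫ x in Ioc 0 (2 * Real.pi), ψ x • g x

/-- The fractional Sobolev space `H^{1/2}(𝕊¹; ℝ³)`: square-integrable maps with finite Gagliardo
seminorm. Two points `x`, `x + t` with `|t| ≤ π` are at distance `|t|` on the circle. -/
structure MemHHalf (f : ℝ → E3) : Prop where
  periodic : Function.Periodic f (2 * Real.pi)
  memLp : MemLp f 2 (volume.restrict (Ioc 0 (2 * Real.pi)))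
  gagliardo : ∫⁻ x in Ioc 0 (2 * Real.pi), ∫⁻ t in Ioc (-Real.pi) Real.pi,
    ‖f (x + t) - f x‖ₑ ^ 2 / ENNReal.ofReal (t ^ 2) < ⊤

/-- `(γ, N)` is an `H^{1/2}`-framed loop and `dγ` is the weak derivative `γ'`:
`γ ∈ H^{3/2}(𝕊¹; ℝ³)` is an immersion (its speed is bounded, and bounded away from zero),
`N ∈ H^{1/2}(𝕊¹; 𝕊²)`, and `γ' ⊥ N` almost everywhere. -/
structure IsHalfFramedLoop (γ dγ N : ℝ → E3) : Prop where
  memLp : MemLp γ 2 (volume.restrict (Ioc 0 (2 * Real.pi)))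
  hasWeakDeriv : HasWeakDeriv γ dγ
  deriv_memHHalf : MemHHalf dγ
  immersion : ∃ c C : ℝ, 0 < c ∧ ∀ᵐ x, c ≤ ‖dγ x‖ ∧ ‖dγ x‖ ≤ C
  normal_memHHalf : MemHHalf N
  normal_unit : ∀ᵐ x, ‖N x‖ = 1
  orthogonal : ∀ᵐ x, inner ℝ (dγ x) (N x) = 0

/-- The length of the loop with velocity `dγ`. -/
noncomputable def loopLength (dγ : ℝ → E3) : ℝ :=
  ∫ x in Ioc 0 (2 * Real.pi), ‖dγ x‖

/-- `∫ |D_s N| dℓ`, where `D_s N = N' / |γ'|` and `dℓ = |γ'| dφ`. The weak derivative `N'` is unique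
up to null sets; if `N ∉ W^{1,1}` there is none, and the value is `∞`. -/
noncomputable def normalVariation (dγ N : ℝ → E3) : ℝ≥0∞ :=
  ⨅ (dN : ℝ → E3) (_ : HasWeakDeriv N dN),
    ∫⁻ x in Ioc 0 (2 * Real.pi), ‖‖dγ x‖⁻¹ • dN x‖ₑ * ‖dγ x‖ₑ

/-- The component of `v` orthogonal to the unit vector `n`. -/
noncomputable def tangentialPart (n v : E3) : E3 := v - (inner ℝ v n) • n

/-- `X` is a parallel field along the circle cut open at `φ₀`, that is, on `(φ₀, φ₀ + 2π)`: it is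
bounded, orthogonal to `N`, and satisfies `X' = ⟨X', N⟩ N`, that is, the component of `X'`
orthogonal to `N` vanishes. As `X` need not have a (weak) derivative when `N` is only in `H^{1/2}`,
the last condition says that the components orthogonal to `N` of the difference quotients
`(X (x + h) - X x) / h` tend to zero in `L¹` as `h ↓ 0`. -/
structure IsParallelField (N : ℝ → E3) (φ₀ : ℝ) (X : ℝ → E3) : Prop where
  bounded : MemLp X ⊤ (volume.restrict (Ioo φ₀ (φ₀ + 2 * Real.pi)))
  orthogonal : ∀ᵐ x ∂(volume.restrict (Ioo φ₀ (φ₀ + 2 * Real.pi))), inner ℝ (X x) (N x) = 0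
  parallel : Tendsto
    (fun h : ℝ => ∫ x in Ioo φ₀ (φ₀ + 2 * Real.pi - h),
      ‖tangentialPart (N x) (h⁻¹ • (X (x + h) - X x))‖) (𝓝[>] 0) (𝓝 0)

/-- `(E 0, E 1)` is a parallel orthonormal frame of the planes `N^⊥ = span {𝔱, 𝔫}` on
`(φ₀, φ₀ + 2π)`. -/
structure IsParallelFrame (N : ℝ → E3) (φ₀ : ℝ) (E : Fin 2 → ℝ → E3) : Prop where
  isParallel : ∀ i, IsParallelField N φ₀ (E i)
  orthonormal : ∀ᵐ x ∂(volume.restrict (Ioo φ₀ (φ₀ + 2 * Real.pi))),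
    Orthonormal ℝ (fun i => E i x)

/-- `e` is the value of `X` at the base point `φ₀`, approached from the right (in the sense of
Lebesgue points, since `X` is only determined almost everywhere). -/
def HasRightValue (X : ℝ → E3) (φ₀ : ℝ) (e : E3) : Prop :=
  Tendsto (fun ε : ℝ => ε⁻¹ * ∫ x in Ioo φ₀ (φ₀ + ε), ‖X x - e‖) (𝓝[>] 0) (𝓝 0)

/-- Parallel transport `Π_{φ, φ₀} v` of `v ⊥ N φ` from `φ ∈ (φ₀, φ₀ + 2π)` down to `φ₀`, written in
a parallel orthonormal frame `E` with value `e` at `φ₀`: the coordinates of `v` are preserved. -/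
noncomputable def transportToBase (E : Fin 2 → ℝ → E3) (e : Fin 2 → E3) (φ : ℝ) (v : E3) : E3 :=
  ∑ i, (inner ℝ v (E i φ)) • e i

/-- `B` is the Burgers vector of the framed loop relative to the base point `φ₀`:
`B = ∫ Π_{φ, φ₀} γ'(φ) dφ`, where `φ` runs once around the circle cut open at `φ₀`. -/
def IsBurgersVector (dγ N : ℝ → E3) (φ₀ : ℝ) (B : E3) : Prop :=
  ∃ (E : Fin 2 → ℝ → E3) (e : Fin 2 → E3), IsParallelFrame N φ₀ E ∧
    (∀ i, HasRightValue (E i) φ₀ (e i)) ∧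
    B = ∫ φ in Ioo φ₀ (φ₀ + 2 * Real.pi), transportToBase E e φ (dγ φ)

end FramedLoop

/-! If the variation is finite, `N` agrees almost everywhere with an absolutely continuous curve `n`
of unit vectors whose derivative is `g = N'`. The skew field `A v = ⟨n, v⟩ g - ⟨g, v⟩ n` has `A n =
g`, so the flow of `X' = A X` carries an orthonormal basis containing `n φ₀` to orthonormal bases
containing `n`. The other two vectors satisfy `Y' = -⟨Y, g⟩ n`, a classical parallel frame
(`exists_isSmoothFrame`).

Uniqueness: a field parallel in the weak `L¹` sense has constant coordinates in `Y`
(`IsParallelField.exists_ae_inner_eq_const`). Hence two parallel frames differ by a constant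
orthogonal matrix, which cancels in the transport (`IsParallelFrame.ae_transportToBase_eq`).

Inequality: the loop closes, so `∫ γ' = 0` and `B = ∫ (Π γ' - γ')`. For `v ⊥ n x`, the parallel
field through `v` has constant norm and derivative at most `‖v‖ ‖g‖`, so `‖Π v - v‖ ≤ ‖v‖ ∫ ‖g‖`
(`IsSmoothFrame.norm_sum_sub_le`). Integrating gives `‖B‖ ≤ Length · ∫ ‖N'‖`. With infinite
variation there is nothing to prove. -/

/-! ### Calculus of absolutely continuous curves -/

/-- `f` is absolutely continuous on `[a, b]` with derivative `f'`: it is a primitive of the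
integrable function `f'`. -/
def IsPrimitiveOn {F : Type*} [NormedAddCommGroup F] [NormedSpace ℝ F] (f f' : ℝ → F)
    (a b : ℝ) : Prop :=
  IntervalIntegrable f' volume a b ∧ ∀ x ∈ Icc a b, f x = f a + ∫ t in a..x, f' t

namespace AbsolutelyContinuousOnInterval

theorem of_dist_le {X Y : Type*} [PseudoMetricSpace X] [PseudoMetricSpace Y] {f : ℝ → X}
    {g : ℝ → Y} {a b : ℝ} (hg : AbsolutelyContinuousOnInterval g a b)
    (h : ∀ x ∈ uIcc a b, ∀ y ∈ uIcc a b, dist (f x) (f y) ≤ dist (g x) (g y)) :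
    AbsolutelyContinuousOnInterval f a b := by
  rw [absolutelyContinuousOnInterval_iff] at hg ⊢
  intro ε hε
  obtain ⟨δ, hδ, H⟩ := hg ε hε
  refine ⟨δ, hδ, fun E hE hEδ => (Finset.sum_le_sum fun i hi => ?_).trans_lt (H E hE hEδ)⟩
  exact h _ (hE.1 i hi).1 _ (hE.1 i hi).2

/-- Polarization reduces this to squares of norms, and the norm is 1-Lipschitz. -/
theorem inner_real {F : Type*} [NormedAddCommGroup F] [InnerProductSpace ℝ F] {f g : ℝ → F}
    {a b : ℝ} (hf : AbsolutelyContinuousOnInterval f a b)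
    (hg : AbsolutelyContinuousOnInterval g a b) :
    AbsolutelyContinuousOnInterval (fun x => inner ℝ (f x) (g x)) a b := by
  have hn : ∀ {k : ℝ → F}, AbsolutelyContinuousOnInterval k a b →
      AbsolutelyContinuousOnInterval (fun x => ‖k x‖) a b := fun hk =>
    hk.of_dist_le fun x _ y _ => by simpa [Real.dist_eq, dist_eq_norm] using abs_norm_sub_norm_le _ _
  have h1 := hn (hf.add hg)
  have h2 := hn (hf.sub hg)
  have h3 := ((h1.mul h1).sub (h2.mul h2)).const_mul (1 / 4)
  convert h3 using 2 with x
  have := re_inner_eq_norm_add_mul_self_sub_norm_sub_mul_self_div_four (𝕜 := ℝ) (f x) (g x)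
  simp only [RCLike.re_to_real] at this
  simp only [this, Pi.sub_apply, Pi.mul_apply, Pi.add_apply]
  ring

end AbsolutelyContinuousOnInterval

namespace IsPrimitiveOn

variable {F : Type*} [NormedAddCommGroup F] [NormedSpace ℝ F] {f f' : ℝ → F} {a b x y : ℝ}

theorem integrable_sub (h : IsPrimitiveOn f f' a b) (hx : x ∈ Icc a b) (hy : y ∈ Icc a b) :
    IntervalIntegrable f' volume x y :=
  h.1.mono_set (by
    rw [uIcc_of_le (hx.1.trans hx.2)]
    exact uIcc_subset_Icc hx hy)

theorem sub_eq (h : IsPrimitiveOn f f' a b) (hx : x ∈ Icc a b) (hy : y ∈ Icc a b) :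
    f y - f x = ∫ t in x..y, f' t := by
  have ha : a ∈ Icc a b := ⟨le_rfl, hx.1.trans hx.2⟩
  rw [h.2 x hx, h.2 y hy, add_sub_add_left_eq_sub,
    intervalIntegral.integral_interval_sub_left (h.integrable_sub ha hy) (h.integrable_sub ha hx)]

theorem absolutelyContinuousOnInterval (h : IsPrimitiveOn f f' a b) (hab : a ≤ b) :
    AbsolutelyContinuousOnInterval f a b := by
  refine (h.1.norm.absolutelyContinuousOnInterval_intervalIntegral (c := a)
    left_mem_uIcc).of_dist_le ?_
  intro x hx y hy
  rw [uIcc_of_le hab] at hx hy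
  have ha : a ∈ Icc a b := ⟨le_rfl, hab⟩
  rw [dist_eq_norm, h.sub_eq hy hx, Real.dist_eq, intervalIntegral.integral_interval_sub_left
    (h.integrable_sub ha hx).norm (h.integrable_sub ha hy).norm]
  exact intervalIntegral.norm_integral_le_abs_integral_norm

theorem continuousOn (h : IsPrimitiveOn f f' a b) (hab : a ≤ b) : ContinuousOn f (Icc a b) := by
  simpa [uIcc_of_le hab] using (h.absolutelyContinuousOnInterval hab).continuousOn

theorem ae_hasDerivAt [CompleteSpace F] (h : IsPrimitiveOn f f' a b) (hab : a ≤ b) :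
    ∀ᵐ x, x ∈ uIcc a b → HasDerivAt f (f' x) x := by
  -- Nothing is known about `f` outside `[a, b]`, so two-sided differentiability is claimed only in
  -- the interior; the endpoints form a null set.
  have hne : ∀ c : ℝ, ∀ᵐ x, x ≠ c := fun c => by simp [ae_iff, measure_singleton]
  filter_upwards [h.1.ae_hasDerivAt_integral, hne a, hne b] with x hx hxa hxb hxm
  have h1 := (hx hxm a left_mem_uIcc).const_add (f a)
  rw [uIcc_of_le hab] at hxm
  have hI : Icc a b ∈ 𝓝 x :=
    Icc_mem_nhds (lt_of_le_of_ne hxm.1 hxa.symm) (lt_of_le_of_ne hxm.2 hxb)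
  exact h1.congr_of_eventuallyEq (by filter_upwards [hI] with y hy using h.2 y hy)

/-- Two absolutely continuous curves whose inner product has vanishing derivative almost
everywhere have constant inner product. -/
theorem inner_eq {F : Type*} [NormedAddCommGroup F] [InnerProductSpace ℝ F] [CompleteSpace F]
    {f f' g g' : ℝ → F} (hf : IsPrimitiveOn f f' a b) (hg : IsPrimitiveOn g g' a b) (hab : a ≤ b)
    (h0 : ∀ᵐ x, x ∈ uIcc a b → inner ℝ (f x) (g' x) + inner ℝ (f' x) (g x) = 0)
    (hx : x ∈ Icc a b) : inner ℝ (f x) (g x) = inner ℝ (f a) (g a) := by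
  obtain ⟨C, hC⟩ := ((hf.absolutelyContinuousOnInterval hab).inner_real
    (hg.absolutelyContinuousOnInterval hab)).const_of_ae_hasDerivAt_zero (by
      filter_upwards [hf.ae_hasDerivAt hab, hg.ae_hasDerivAt hab, h0] with y h1 h2 h3 hy
      have := (h1 hy).inner ℝ (h2 hy)
      rwa [h3 hy] at this)
  rw [hC x (by rwa [uIcc_of_le hab]), hC a left_mem_uIcc]

end IsPrimitiveOn

/-! ### Linear differential equations with integrable coefficients -/

/-- Supplies the factorial in the Picard iteration: the integrand is the derivative of `G ^ (n + 1)
/ (n + 1)!` with `G` the primitive of `k`. -/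
theorem integral_pow_mul_primitive {k : ℝ → ℝ} {a b : ℝ} (hab : a ≤ b)
    (hk : IntervalIntegrable k volume a b) (n : ℕ) :
    ∫ t in a..b, k t * (∫ s in a..t, k s) ^ n / n.factorial =
      (∫ s in a..b, k s) ^ (n + 1) / (n + 1).factorial := by
  set G : ℝ → ℝ := fun t => ∫ s in a..t, k s with hG
  have hp : IsPrimitiveOn G k a b := ⟨hk, fun x _ => by simp [hG]⟩
  have hAC := hp.absolutelyContinuousOnInterval hab
  have hpow : ∀ m : ℕ, AbsolutelyContinuousOnInterval (fun t => G t ^ (m + 1)) a b := by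
    intro m
    induction m with
    | zero => simpa using hAC
    | succ m ih => simpa only [pow_succ _ (m + 1)] using ih.fun_mul hAC
  have h1 := ((hpow n).const_mul (1 / ((n + 1).factorial : ℝ))).integral_deriv_eq_sub
  have h2 : ∫ t in a..b, k t * G t ^ n / n.factorial =
      ∫ t in a..b, deriv (fun t => 1 / ((n + 1).factorial : ℝ) * G t ^ (n + 1)) t := by
    apply intervalIntegral.integral_congr_ae
    filter_upwards [hp.ae_hasDerivAt hab] with t ht htm
    have h3 := (((ht (uIoc_subset_uIcc htm)).pow (n + 1)).const_mul
      (1 / ((n + 1).factorial : ℝ))).deriv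
    simp only [Pi.pow_apply] at h3
    rw [h3, Nat.factorial_succ]
    push_cast
    have : (n.factorial : ℝ) ≠ 0 := by positivity
    have : (n + 1 : ℝ) ≠ 0 := by positivity
    field_simp
  rw [h2, h1]
  simp [hG]
  ring

/-- Linear differential equations with integrable coefficients are solvable. -/
theorem exists_isPrimitiveOn_linear {F : Type*} [NormedAddCommGroup F] [NormedSpace ℝ F]
    [CompleteSpace F] {A : ℝ → F →L[ℝ] F} {a b : ℝ} (hab : a ≤ b)
    (hA : IntervalIntegrable A volume a b) (x₀ : F) :
    ∃ X : ℝ → F, Continuous X ∧ X a = x₀ ∧ IsPrimitiveOn X (fun t => A t (X t)) a b := by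
  have hint : ∀ X : ℝ → F, Continuous X → ∀ c ∈ Icc a b, ∀ d ∈ Icc a b,
      IntervalIntegrable (fun t => A t (X t)) volume c d := by
    intro X hX c hc d hd
    have hA' : IntervalIntegrable A volume c d := hA.mono_set (by
      rw [uIcc_of_le hab]; exact uIcc_subset_Icc hc hd)
    obtain ⟨C, hC⟩ := isCompact_uIcc.exists_bound_of_continuousOn (hX.continuousOn (s := uIcc c d))
    refine (hA'.norm.const_mul C).mono_fun ?_ ?_
    · exact (ContinuousLinearMap.apply ℝ F).flip.aestronglyMeasurable_comp₂
        (intervalIntegrable_iff.1 hA').aestronglyMeasurable hX.aestronglyMeasurable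
    · refine (ae_restrict_iff' measurableSet_uIoc).2 (.of_forall fun t ht => ?_)
      have h1 := hC t (uIoc_subset_uIcc ht)
      simp only [norm_mul, norm_norm, mul_comm ‖C‖]
      refine ((A t).le_opNorm _).trans ?_
      gcongr
      exact h1.trans (le_abs_self C)
  have ha : a ∈ Icc a b := ⟨le_rfl, hab⟩
  have hext : ∀ X : C(Icc a b, F), Continuous (IccExtend hab X) := fun X => X.continuous.Icc_extend'
  have hTc : ∀ X : C(Icc a b, F),
      Continuous fun t : Icc a b => x₀ + ∫ s in a..t, A s (IccExtend hab X s) := by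
    intro X
    have : IsPrimitiveOn (fun t => x₀ + ∫ s in a..t, A s (IccExtend hab X s))
        (fun s => A s (IccExtend hab X s)) a b :=
      ⟨hint _ (hext X) a ha b ⟨hab, le_rfl⟩, fun x _ => by simp⟩
    exact (this.continuousOn hab).domRestrict
  let T : C(Icc a b, F) → C(Icc a b, F) := fun X => ⟨_, hTc X⟩
  set G : ℝ → ℝ := fun t => ∫ s in a..t, ‖A s‖ with hG
  have hGnn : ∀ t ∈ Icc a b, 0 ≤ G t := fun t ht =>
    intervalIntegral.integral_nonneg ht.1 fun _ _ => norm_nonneg _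
  have hGc : ContinuousOn G (Icc a b) :=
    IsPrimitiveOn.continuousOn (f' := fun s => ‖A s‖) ⟨hA.norm, fun x _ => by simp [hG]⟩ hab
  have hiter : ∀ (n : ℕ) (X Y : C(Icc a b, F)) (t : Icc a b),
      ‖(T^[n] X) t - (T^[n] Y) t‖ ≤ G t ^ n / n.factorial * dist X Y := by
    intro n X Y
    induction n with
    | zero => intro t; simpa [dist_eq_norm] using ContinuousMap.norm_coe_le_norm (X - Y) t
    | succ n ih =>
      intro t
      rw [Function.iterate_succ_apply', Function.iterate_succ_apply']
      have hAt : IntervalIntegrable A volume a t := hA.mono_set (by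
        rw [uIcc_of_le hab]; exact uIcc_subset_Icc ha t.2)
      have e1 : (T (T^[n] X)) t - (T (T^[n] Y)) t =
          ∫ s in a..t, A s (IccExtend hab (T^[n] X) s - IccExtend hab (T^[n] Y) s) := by
        simp only [T, ContinuousMap.coe_mk, add_sub_add_left_eq_sub, map_sub]
        rw [intervalIntegral.integral_sub (hint _ (hext _) _ ha _ t.2) (hint _ (hext _) _ ha _ t.2)]
      rw [e1, ← integral_pow_mul_primitive t.2.1 hAt.norm n, ← intervalIntegral.integral_mul_const]
      refine intervalIntegral.norm_integral_le_of_norm_le t.2.1 (.of_forall fun s hs => ?_) ?_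
      · have hs' : s ∈ Icc a b := ⟨hs.1.le, hs.2.trans t.2.2⟩
        refine ((A s).le_opNorm _).trans ?_
        rw [IccExtend_of_mem _ _ hs', IccExtend_of_mem _ _ hs', mul_div_assoc, mul_assoc]
        exact mul_le_mul_of_nonneg_left (ih ⟨s, hs'⟩) (norm_nonneg _)
      · simp_rw [mul_div_assoc, mul_assoc]
        refine hAt.norm.mul_continuousOn ?_
        have : uIcc a (t : ℝ) ⊆ Icc a b := uIcc_subset_Icc ha t.2
        exact (((hGc.mono this).pow n).div_const _).mul continuousOn_const
  -- The Picard map need not contract when `∫ ‖A‖` is large, but its `n`-th iterate has Lipschitz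
  -- constant `G b ^ n / n!`, which tends to zero.
  obtain ⟨n, hn⟩ : ∃ n : ℕ, G b ^ n / n.factorial < 1 / 2 :=
    ((FloorSemiring.tendsto_pow_div_factorial_atTop (G b)).eventually
      (gt_mem_nhds (by norm_num))).exists
  have hcontr : ContractingWith (1 / 2) T^[n] := by
    refine ⟨by rw [← NNReal.coe_lt_coe]; norm_num, LipschitzWith.of_dist_le_mul fun X Y => ?_⟩
    rw [ContinuousMap.dist_le (by positivity)]
    intro t
    rw [dist_eq_norm]
    refine (hiter n X Y t).trans (mul_le_mul_of_nonneg_right ?_ dist_nonneg)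
    have hGt : G t ≤ G b := by
      have h2 : IntervalIntegrable (fun s => ‖A s‖) volume t b := (hA.mono_set (by
        rw [uIcc_of_le hab]; exact uIcc_subset_Icc t.2 ⟨hab, le_rfl⟩)).norm
      have h1 : IntervalIntegrable (fun s => ‖A s‖) volume a t := (hA.mono_set (by
        rw [uIcc_of_le hab]; exact uIcc_subset_Icc ha t.2)).norm
      have h3 := intervalIntegral.integral_add_adjacent_intervals h1 h2
      have h4 : 0 ≤ ∫ s in (t : ℝ)..b, ‖A s‖ :=
        intervalIntegral.integral_nonneg t.2.2 fun _ _ => norm_nonneg _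
      simp only [hG]
      linarith
    have := hGnn t t.2
    calc G t ^ n / n.factorial ≤ G b ^ n / n.factorial := by gcongr
      _ ≤ _ := by simpa using hn.le
  -- The Picard map sends the unique fixed point of its iterate to a fixed point of that iterate,
  -- hence fixes it.
  have hfix := hcontr.isFixedPt_fixedPoint_iterate
  set X := hcontr.fixedPoint T^[n]
  have hX : ∀ t (ht : t ∈ Icc a b),
      IccExtend hab X t = x₀ + ∫ s in a..t, A s (IccExtend hab X s) := by
    intro t ht
    rw [IccExtend_of_mem _ _ ht]
    exact (DFunLike.congr_fun hfix ⟨t, ht⟩).symm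
  have hXa : IccExtend hab X a = x₀ := by simpa using hX a ha
  exact ⟨IccExtend hab X, hext X, hXa, hint _ (hext X) a ha b ⟨hab, le_rfl⟩,
    fun t ht => by rw [hXa, hX t ht]⟩

/-! ### Weak derivatives on the circle and absolutely continuous representatives -/

/-- The difference of `f` and the primitive of `f'` is absolutely continuous with derivative zero
almost everywhere, hence constant. -/
theorem IsPrimitiveOn.of_absolutelyContinuousOnInterval {F : Type*} [NormedAddCommGroup F]
    [NormedSpace ℝ F] [CompleteSpace F] {f f' : ℝ → F} {a b : ℝ} (hab : a ≤ b)
    (hf : AbsolutelyContinuousOnInterval f a b) (hf' : IntervalIntegrable f' volume a b)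
    (hd : ∀ᵐ x, x ∈ uIcc a b → HasDerivAt f (f' x) x) : IsPrimitiveOn f f' a b := by
  have hp : IsPrimitiveOn (fun x => ∫ t in a..x, f' t) f' a b := ⟨hf', fun x _ => by simp⟩
  obtain ⟨C, hC⟩ := (hf.sub (hp.absolutelyContinuousOnInterval hab)).const_of_ae_hasDerivAt_zero (by
    filter_upwards [hd, hp.ae_hasDerivAt hab] with x h1 h2 hx
    simpa using (h1 hx).sub (h2 hx))
  refine ⟨hf', fun x hx => ?_⟩
  have h1 := hC x (by rwa [uIcc_of_le hab])
  have h2 := hC a left_mem_uIcc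
  simp only [Pi.sub_apply, intervalIntegral.integral_same, sub_zero] at h1 h2
  rw [h2, ← h1, sub_add_cancel]

theorem IsPrimitiveOn.smul_contDiff {F : Type*} [NormedAddCommGroup F] [NormedSpace ℝ F]
    [CompleteSpace F] {f f' : ℝ → F} {a b : ℝ} (hab : a ≤ b) (hf : IsPrimitiveOn f f' a b)
    {ψ : ℝ → ℝ} (hψ : ContDiff ℝ ∞ ψ) :
    IsPrimitiveOn (fun x => ψ x • f x) (fun x => ψ x • f' x + deriv ψ x • f x) a b := by
  have hc : Continuous (deriv ψ) := hψ.continuous_deriv (by simp)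
  refine .of_absolutelyContinuousOnInterval hab
    (((hψ.of_le (by simp)).contDiffOn.absolutelyContinuousOnInterval).smul
      (hf.absolutelyContinuousOnInterval hab)) ?_ ?_
  · refine (hf.1.continuousOn_smul hψ.continuous.continuousOn).add ?_
    refine ContinuousOn.intervalIntegrable (hc.continuousOn.smul ?_)
    rw [uIcc_of_le hab]
    exact hf.continuousOn hab
  · filter_upwards [hf.ae_hasDerivAt hab] with x hx hxm
    exact ((hψ.differentiable (by simp)) x).hasDerivAt.smul (hx hxm)

/-- A smooth function supported in the interior of a period extends periodically. -/
theorem exists_periodic_extension {ρ : ℝ → ℝ} {a p : ℝ} (hp : 0 < p) (hρ : ContDiff ℝ ∞ ρ)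
    (hsupp : tsupport ρ ⊆ Ioo a (a + p)) :
    ∃ φ : ℝ → ℝ, ContDiff ℝ ∞ φ ∧ Function.Periodic φ p ∧ ∀ x ∈ Ico a (a + p), φ x = ρ x := by
  have hper : Function.Periodic (fun x => ρ (toIcoMod hp a x)) p := fun x => by simp
  refine ⟨fun x => ρ (toIcoMod hp a x), ?_, hper, fun x hx => ?_⟩
  · rw [contDiff_iff_contDiffAt]
    suffices h : ∀ y ∈ Ico a (a + p), ContDiffAt ℝ ∞ (fun x => ρ (toIcoMod hp a x)) y by
      intro x
      have h1 := h _ (toIcoMod_mem_Ico hp a x)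
      have h2 : (fun x => ρ (toIcoMod hp a x)) =
          (fun x => ρ (toIcoMod hp a x)) ∘ fun z => z - toIcoDiv hp a x • p := by
        funext z
        simp
      rw [h2]
      exact ContDiffAt.comp x h1 (by fun_prop)
    intro y hy
    -- At the seam `a` the extension is locally zero, since `ρ` vanishes near both `a` and `a + p`;
    -- elsewhere it is locally `ρ`.
    rcases hy.1.eq_or_lt with rfl | hlt
    · have h0 : ∀ c, c ∉ Ioo a (a + p) → ∀ᶠ x in 𝓝 c, ρ x = 0 := fun c hc => by
        have : c ∉ tsupport ρ := fun h => hc (hsupp h)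
        exact notMem_tsupport_iff_eventuallyEq.1 this
      have h2 : ∀ᶠ x in 𝓝 a, ρ (x + p) = 0 :=
        ((continuous_id.add continuous_const).tendsto a).eventually (h0 (a + p) (by simp))
      refine contDiffAt_const (c := (0 : ℝ)) |>.congr_of_eventuallyEq ?_
      filter_upwards [h0 a (by simp), h2,
        Ioo_mem_nhds (show a - p < a by linarith) (show a < a + p by linarith)] with x h3 h4 h5
      rcases le_or_gt a x with h | h
      · rwa [(toIcoMod_eq_self hp).2 ⟨h, h5.2⟩]
      · rwa [← toIcoMod_add_right hp a x, (toIcoMod_eq_self hp).2 ⟨by linarith [h5.1], by linarith⟩]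
    · refine hρ.contDiffAt.congr_of_eventuallyEq ?_
      filter_upwards [Ioo_mem_nhds hlt hy.2] with x hx
      rw [(toIcoMod_eq_self hp).2 ⟨hx.1.le, hx.2⟩]
  · simp only [(toIcoMod_eq_self hp).2 hx]

/-- Zero mean over a period is exactly what makes the primitive periodic. -/
theorem exists_periodic_primitive {φ : ℝ → ℝ} {a p : ℝ} (hφ : ContDiff ℝ ∞ φ)
    (hper : Function.Periodic φ p) (h0 : ∫ t in a..a + p, φ t = 0) :
    ∃ ψ : ℝ → ℝ, ContDiff ℝ ∞ ψ ∧ Function.Periodic ψ p ∧ deriv ψ = φ := by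
  have hd : ∀ x, HasDerivAt (fun x => ∫ t in a..x, φ t) (φ x) x := fun x =>
    hφ.continuous.integral_hasStrictDerivAt a x |>.hasDerivAt
  have hd' : deriv (fun x => ∫ t in a..x, φ t) = φ := funext fun x => (hd x).deriv
  refine ⟨fun x => ∫ t in a..x, φ t, ?_, fun x => ?_, hd'⟩
  · rw [contDiff_infty_iff_deriv, hd']
    exact ⟨fun x => (hd x).differentiableAt, hφ⟩
  · have hi := fun c d => hφ.continuous.intervalIntegrable (μ := volume) c d
    change ∫ t in a..x + p, φ t = ∫ t in a..x, φ t
    rw [← intervalIntegral.integral_add_adjacent_intervals (hi a x) (hi x (x + p)),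
      hper.intervalIntegral_add_eq x a, h0, add_zero]

/-- The du Bois-Reymond lemma on the circle. -/
theorem ae_eq_const_of_integral_deriv_smul_eq_zero {F : Type*} [NormedAddCommGroup F]
    [NormedSpace ℝ F] [CompleteSpace F] {u : ℝ → F} {a p : ℝ} (hp : 0 < p)
    (hu : IntervalIntegrable u volume a (a + p))
    (h : ∀ ψ : ℝ → ℝ, ContDiff ℝ ∞ ψ → Function.Periodic ψ p →
      ∫ x in a..a + p, deriv ψ x • u x = 0) :
    ∃ c : F, ∀ᵐ x, x ∈ Ioo a (a + p) → u x = c := by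
  refine ⟨p⁻¹ • ∫ x in a..a + p, u x, ?_⟩
  set c : F := p⁻¹ • ∫ x in a..a + p, u x with hc
  have hab : a ≤ a + p := by linarith
  have hu' : IntervalIntegrable (fun x => u x - c) volume a (a + p) :=
    hu.sub intervalIntegrable_const
  have key := isOpen_Ioo.ae_eq_zero_of_integral_contDiff_smul_eq_zero (U := Ioo a (a + p))
    (f := fun x => u x - c) (μ := volume)
    (((intervalIntegrable_iff_integrableOn_Ioo_of_le hab).1 hu').locallyIntegrableOn) ?_
  · filter_upwards [key] with x hx hxm
    exact sub_eq_zero.1 (hx hxm)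
  intro ρ hρ _ hsupp
  obtain ⟨φ, hφ, hper, hφρ⟩ := exists_periodic_extension hp hρ hsupp
  -- Only derivatives of periodic functions are admissible, so the mean of `φ` is removed. Since `c`
  -- is the mean of `u`, `∫ φ • (u - c) = ∫ (φ - m) • u`, and `φ - m` is such a derivative.
  set m : ℝ := p⁻¹ * ∫ x in a..a + p, φ x with hm
  have hφi : IntervalIntegrable φ volume a (a + p) := hφ.continuous.intervalIntegrable _ _
  obtain ⟨ψ, hψ, hψp, hψd⟩ := exists_periodic_primitive (φ := fun x => φ x - m) (a := a) (p := p)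
    (hφ.sub contDiff_const) (fun x => by simp [hper x]) (by
      rw [intervalIntegral.integral_sub hφi intervalIntegrable_const, hm]
      simp [hp.ne'])
  have h1 := h ψ hψ hψp
  have hφu : IntervalIntegrable (fun x => φ x • u x) volume a (a + p) :=
    hu.continuousOn_smul hφ.continuous.continuousOn
  have hmu : IntervalIntegrable (fun x => m • u x) volume a (a + p) := hu.smul m
  simp only [hψd, sub_smul] at h1
  rw [intervalIntegral.integral_sub hφu hmu, intervalIntegral.integral_smul] at h1
  have h2 : ∫ x, ρ x • (u x - c) = ∫ x in Ioo a (a + p), φ x • (u x - c) := by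
    rw [← setIntegral_eq_integral_of_forall_compl_eq_zero (s := Ioo a (a + p))]
    · exact setIntegral_congr_fun measurableSet_Ioo fun x hx => by
        simp only [hφρ x ⟨hx.1.le, hx.2⟩]
    · intro x hx
      rw [image_eq_zero_of_notMem_tsupport fun h => hx (hsupp h), zero_smul]
  rw [h2, ← integral_Ioc_eq_integral_Ioo, ← intervalIntegral.integral_of_le hab]
  have hφc : IntervalIntegrable (fun x => φ x • c) volume a (a + p) :=
    (hφ.continuous.smul continuous_const).intervalIntegrable _ _
  simp only [smul_sub]
  rw [intervalIntegral.integral_sub hφu hφc, intervalIntegral.integral_smul_const, hc,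
    smul_smul, mul_comm, ← hm]
  exact h1

namespace FramedLoop

theorem HasWeakDeriv.intervalIntegrable_deriv {f g : ℝ → E3} (h : HasWeakDeriv f g) (a b : ℝ) :
    IntervalIntegrable g volume a b :=
  h.periodic_deriv.intervalIntegrable₀ Real.two_pi_pos.ne'
    ((intervalIntegrable_iff_integrableOn_Ioc_of_le Real.two_pi_pos.le).2 h.integrable_deriv) a b

theorem HasWeakDeriv.intervalIntegrable_fun {f g : ℝ → E3} (h : HasWeakDeriv f g) (a b : ℝ) :
    IntervalIntegrable f volume a b :=
  h.periodic_fun.intervalIntegrable₀ Real.two_pi_pos.ne'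
    ((intervalIntegrable_iff_integrableOn_Ioc_of_le Real.two_pi_pos.le).2 h.integrable_fun) a b

theorem HasWeakDeriv.intervalIntegral_test {f g : ℝ → E3} (h : HasWeakDeriv f g) (a : ℝ)
    {ψ : ℝ → ℝ} (hψ : ContDiff ℝ ∞ ψ) (hp : Function.Periodic ψ (2 * Real.pi)) :
    ∫ x in a..a + 2 * Real.pi, deriv ψ x • f x = - ∫ x in a..a + 2 * Real.pi, ψ x • g x := by
  have hd : Function.Periodic (deriv ψ) (2 * Real.pi) := fun x => by
    rw [← deriv_comp_add_const, funext hp]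
  have h1 : Function.Periodic (fun x => deriv ψ x • f x) (2 * Real.pi) := fun x => by
    simp only [hd x, h.periodic_fun x]
  have h2 : Function.Periodic (fun x => ψ x • g x) (2 * Real.pi) := fun x => by
    simp only [hp x, h.periodic_deriv x]
  rw [h1.intervalIntegral_add_eq a 0, h2.intervalIntegral_add_eq a 0, zero_add,
    intervalIntegral.integral_of_le Real.two_pi_pos.le,
    intervalIntegral.integral_of_le Real.two_pi_pos.le]
  exact h.integral_test ψ hψ hp

theorem HasWeakDeriv.integral_deriv_eq_zero {f g : ℝ → E3} (h : HasWeakDeriv f g) (a : ℝ) :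
    ∫ x in a..a + 2 * Real.pi, g x = 0 := by
  have := h.intervalIntegral_test a (ψ := fun _ => 1) contDiff_const fun _ => rfl
  simpa using this.symm

/-- A `W^{1,1}` map on the circle has an absolutely continuous representative. -/
theorem HasWeakDeriv.exists_isPrimitiveOn {f g : ℝ → E3} (h : HasWeakDeriv f g) (a : ℝ) :
    ∃ n : ℝ → E3, IsPrimitiveOn n g a (a + 2 * Real.pi) ∧
      ∀ᵐ x, x ∈ Ioo a (a + 2 * Real.pi) → f x = n x := by
  have hp := Real.two_pi_pos
  have hab : a ≤ a + 2 * Real.pi := by linarith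
  have hg := h.intervalIntegrable_deriv a (a + 2 * Real.pi)
  have hf := h.intervalIntegrable_fun a (a + 2 * Real.pi)
  have hF : IsPrimitiveOn (fun x => ∫ t in a..x, g t) g a (a + 2 * Real.pi) :=
    ⟨hg, fun x _ => by simp⟩
  have hFi : IntervalIntegrable (fun x => ∫ t in a..x, g t) volume a (a + 2 * Real.pi) :=
    ContinuousOn.intervalIntegrable (by rw [uIcc_of_le hab]; exact hF.continuousOn hab)
  -- The primitive of `g` vanishes at both ends, because `g` has mean zero. Integration by parts
  -- thus has no boundary term, and `f` minus this primitive annihilates every `deriv ψ`.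
  obtain ⟨c, hc⟩ := ae_eq_const_of_integral_deriv_smul_eq_zero hp (hf.sub hFi) (by
    intro ψ hψ hψp
    have hc : Continuous (deriv ψ) := hψ.continuous_deriv (by simp)
    have h1 := (hF.smul_contDiff hab hψ).sub_eq (left_mem_Icc.2 hab) (right_mem_Icc.2 hab)
    rw [intervalIntegral.integral_add (hg.continuousOn_smul hψ.continuous.continuousOn)
      (hFi.continuousOn_smul hc.continuousOn), h.integral_deriv_eq_zero a] at h1
    simp only [smul_sub]
    rw [intervalIntegral.integral_sub (hf.continuousOn_smul hc.continuousOn)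
      (hFi.continuousOn_smul hc.continuousOn), h.intervalIntegral_test a hψ hψp]
    simp only [smul_zero, intervalIntegral.integral_same, sub_zero] at h1
    rw [← neg_add', ← h1, neg_zero])
  refine ⟨fun x => c + ∫ t in a..x, g t, ⟨hg, fun x _ => by simp⟩, ?_⟩
  filter_upwards [hc] with x hx hxm
  rw [← hx hxm]
  simp

end FramedLoop

/-! ### Classical parallel frames along an absolutely continuous normal -/

/-- The infinitesimal rotation `v ↦ ⟨p, v⟩ q - ⟨q, v⟩ p` in the plane spanned by `p` and `q`. -/
noncomputable def planeRotation {F : Type*} [NormedAddCommGroup F] [InnerProductSpace ℝ F]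
    (p q : F) : F →L[ℝ] F :=
  ContinuousLinearMap.smulRightL ℝ F F (innerSL ℝ p) q -
    ContinuousLinearMap.smulRightL ℝ F F (innerSL ℝ q) p

theorem planeRotation_apply {F : Type*} [NormedAddCommGroup F] [InnerProductSpace ℝ F]
    (p q v : F) :
    planeRotation p q v = inner ℝ p v • q - inner ℝ q v • p := by
  simp [planeRotation]

theorem continuous_planeRotation {F : Type*} [NormedAddCommGroup F] [InnerProductSpace ℝ F] :
    Continuous fun p : F × F => planeRotation p.1 p.2 := by
  unfold planeRotation
  fun_prop

theorem norm_planeRotation_le {F : Type*} [NormedAddCommGroup F] [InnerProductSpace ℝ F]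
    (p q : F) : ‖planeRotation p q‖ ≤ 2 * (‖p‖ * ‖q‖) := by
  refine ContinuousLinearMap.opNorm_le_bound _ (by positivity) fun v => ?_
  rw [planeRotation_apply]
  refine (norm_sub_le _ _).trans ?_
  rw [norm_smul, norm_smul]
  have h1 := mul_le_mul_of_nonneg_right (norm_inner_le_norm (𝕜 := ℝ) p v) (norm_nonneg q)
  have h2 := mul_le_mul_of_nonneg_right (norm_inner_le_norm (𝕜 := ℝ) q v) (norm_nonneg p)
  linarith

theorem intervalIntegrable_planeRotation {F : Type*} [NormedAddCommGroup F] [InnerProductSpace ℝ F]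
    {n g : ℝ → F} {a b : ℝ} (hab : a ≤ b)
    (hn : IsPrimitiveOn n g a b) (h1 : ∀ x ∈ Icc a b, ‖n x‖ = 1) :
    IntervalIntegrable (fun t => planeRotation (n t) (g t)) volume a b := by
  have hgi := hn.1
  have hgm := (intervalIntegrable_iff.1 hn.1).aestronglyMeasurable
  have hncont : ContinuousOn n (uIcc a b) := by rw [uIcc_of_le hab]; exact hn.continuousOn hab
  have hnm : AEStronglyMeasurable n (volume.restrict (uIoc a b)) :=
    (intervalIntegrable_iff.1 hncont.intervalIntegrable).aestronglyMeasurable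
  have hm := (continuous_planeRotation (F := F)).comp_aestronglyMeasurable (hnm.prodMk hgm)
  rw [intervalIntegrable_iff] at hgi ⊢
  refine Integrable.mono' (hgi.norm.const_mul 2) hm ?_
  refine (ae_restrict_iff' measurableSet_uIoc).2 (.of_forall fun t ht => ?_)
  have ht' : t ∈ Icc a b := by rw [← uIcc_of_le hab]; exact uIoc_subset_uIcc ht
  have := norm_planeRotation_le (n t) (g t)
  rwa [h1 t ht', one_mul] at this

namespace FramedLoop

/-- `Y` is an absolutely continuous parallel orthonormal frame of `n^⊥` on `[a, b]`, where `n` is a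
curve of unit vectors with derivative `g`. -/
structure IsSmoothFrame (n g : ℝ → E3) (a b : ℝ) (Y : Fin 2 → ℝ → E3) : Prop where
  isPrimitiveOn : ∀ i, IsPrimitiveOn (Y i) (fun t => (-(inner ℝ (Y i t) (g t))) • n t) a b
  orthonormal : ∀ x ∈ Icc a b, Orthonormal ℝ fun i => Y i x
  orthogonal : ∀ i, ∀ x ∈ Icc a b, inner ℝ (Y i x) (n x) = 0
  expansion : ∀ x ∈ Icc a b, ∀ v, inner ℝ v (n x) = 0 → v = ∑ i, inner ℝ v (Y i x) • Y i x

/-- Differentiate `⟨n, n⟩ = 1`. -/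
theorem ae_inner_deriv_eq_zero {n g : ℝ → E3} {a b : ℝ} (hab : a ≤ b)
    (hn : IsPrimitiveOn n g a b) (h1 : ∀ x ∈ Icc a b, ‖n x‖ = 1) :
    ∀ᵐ x, x ∈ uIcc a b → inner ℝ (n x) (g x) = 0 := by
  have hne : ∀ c : ℝ, ∀ᵐ x, x ≠ c := fun c => by simp [ae_iff, measure_singleton]
  filter_upwards [hn.ae_hasDerivAt hab, hne a, hne b] with x hx hxa hxb hxm
  have hd := (hx hxm).inner ℝ (hx hxm)
  rw [uIcc_of_le hab] at hxm
  have hI : Icc a b ∈ 𝓝 x :=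
    Icc_mem_nhds (lt_of_le_of_ne hxm.1 hxa.symm) (lt_of_le_of_ne hxm.2 hxb)
  have h0 : HasDerivAt (fun t => inner ℝ (n t) (n t)) (0 : ℝ) x :=
    (hasDerivAt_const x (1 : ℝ)).congr_of_eventuallyEq (by
      filter_upwards [hI] with y hy
      rw [real_inner_self_eq_norm_sq, h1 y hy, one_pow])
  have := hd.unique h0
  rw [real_inner_comm (n x) (g x)] at this
  linarith

theorem exists_isSmoothFrame {n g : ℝ → E3} {a b : ℝ} (hab : a ≤ b)
    (hn : IsPrimitiveOn n g a b) (h1 : ∀ x ∈ Icc a b, ‖n x‖ = 1) :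
    ∃ Y, IsSmoothFrame n g a b Y := by
  have ha : a ∈ Icc a b := ⟨le_rfl, hab⟩
  have hperp := ae_inner_deriv_eq_zero hab hn h1
  obtain ⟨e, he⟩ : ∃ e : OrthonormalBasis (Fin 3) ℝ E3, e 2 = n a := by
    obtain ⟨e, he⟩ := Orthonormal.exists_orthonormalBasis_extension_of_card_eq (𝕜 := ℝ) (E := E3)
      (ι := Fin 3) (by simp) (v := fun _ => n a) (s := {2}) (by
        constructor
        · intro i
          simpa using h1 a ha
        · intro i j hij
          exact absurd (Subsingleton.elim i j) hij)
    exact ⟨e, he 2 rfl⟩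
  obtain ⟨A, hAint, hAapp⟩ : ∃ A : ℝ → E3 →L[ℝ] E3, IntervalIntegrable A volume a b ∧
      ∀ t v, A t v = inner ℝ (n t) v • g t - inner ℝ (g t) v • n t :=
    ⟨_, intervalIntegrable_planeRotation hab hn h1, fun t v => planeRotation_apply _ _ v⟩
  choose X hXc hXa hXp using fun i => exists_isPrimitiveOn_linear hab hAint (e i)
  -- `n` solves the same equation as the `X i`: `A n = g` because `‖n‖ = 1` and `⟨n, g⟩ = 0`.
  have hnp : IsPrimitiveOn n (fun t => A t (n t)) a b := by
    have hcongr : ∀ᵐ t, t ∈ uIcc a b → g t = A t (n t) := by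
      filter_upwards [hperp] with t ht htm
      rw [hAapp, real_inner_comm (n t) (g t), ht htm, real_inner_self_eq_norm_sq,
        h1 t (by rwa [uIcc_of_le hab] at htm)]
      simp
    refine ⟨hn.1.congr_ae ((ae_restrict_iff' measurableSet_uIoc).2 (by
      filter_upwards [hcongr] with t ht htm using ht (uIoc_subset_uIcc htm))), fun x hx => ?_⟩
    rw [hn.2 x hx]
    congr 1
    refine intervalIntegral.integral_congr_ae ?_
    filter_upwards [hcongr] with t ht htm
    exact ht (by
      rw [uIoc_of_le hx.1] at htm
      rw [uIcc_of_le hab]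
      exact ⟨htm.1.le, htm.2.trans hx.2⟩)
  -- `A` is skew, so inner products of solutions are conserved.
  have hconst : ∀ {P Q : ℝ → E3}, IsPrimitiveOn P (fun t => A t (P t)) a b →
      IsPrimitiveOn Q (fun t => A t (Q t)) a b → ∀ x ∈ Icc a b,
      inner ℝ (P x) (Q x) = inner ℝ (P a) (Q a) := by
    intro P Q hP hQ x hx
    refine hP.inner_eq hQ hab (.of_forall fun t _ => ?_) hx
    simp only [hAapp, inner_sub_left, inner_sub_right, real_inner_smul_left, real_inner_smul_right]
    rw [real_inner_comm (P t) (g t), real_inner_comm (P t) (n t)]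
    ring
  have hXX : ∀ x ∈ Icc a b, Orthonormal ℝ fun i => X i x := by
    intro x hx
    rw [orthonormal_iff_ite]
    intro i j
    rw [hconst (hXp i) (hXp j) x hx, hXa, hXa]
    exact orthonormal_iff_ite.1 e.orthonormal i j
  have hXn : ∀ i, ∀ x ∈ Icc a b, inner ℝ (X i x) (n x) = if i = 2 then 1 else 0 := by
    intro i x hx
    rw [hconst (hXp i) hnp x hx, hXa, ← he]
    exact orthonormal_iff_ite.1 e.orthonormal i 2
  have hne2 : ∀ i : Fin 2, i.castSucc ≠ (2 : Fin 3) := by decide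
  -- The solution of index `2` starts at `n a` and stays equal to `n`; the first two form the frame
  -- of its orthogonal plane.
  refine ⟨fun i => X i.castSucc, ⟨fun i => ?_, fun x hx => ?_, fun i x hx => ?_, fun x hx v hv => ?_⟩⟩
  · have hfun : ∀ t ∈ Icc a b, A t (X i.castSucc t) = (-(inner ℝ (X i.castSucc t) (g t))) • n t := by
      intro t ht
      rw [hAapp, real_inner_comm, hXn _ t ht, if_neg (hne2 i), real_inner_comm]
      simp
    refine ⟨(hXp i.castSucc).1.congr fun t ht => hfun t ?_, fun x hx => ?_⟩
    · rw [← uIcc_of_le hab]; exact uIoc_subset_uIcc ht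
    · rw [(hXp i.castSucc).2 x hx]
      congr 1
      refine intervalIntegral.integral_congr fun t ht => hfun t ?_
      rw [uIcc_of_le hx.1] at ht
      exact ⟨ht.1, ht.2.trans hx.2⟩
  · exact (hXX x hx).comp _ (Fin.castSucc_injective 2)
  · rw [hXn _ x hx, if_neg (hne2 i)]
  · have hcard : Fintype.card (Fin 3) = Module.finrank ℝ E3 := by simp
    let bb := (basisOfOrthonormalOfCardEqFinrank (hXX x hx) hcard).toOrthonormalBasis (by
      simpa using hXX x hx)
    have hb : ∀ i, bb i = X i x := fun i => by simp [bb]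
    have hexp : ∀ w, w = ∑ i, inner ℝ (X i x) w • X i x := fun w => by
      simpa only [hb] using (bb.sum_repr' w).symm
    have hn2 : n x = X 2 x := by
      rw [hexp (n x)]
      simp [hXn _ x hx]
    have := hexp v
    rw [Fin.sum_univ_castSucc] at this
    rw [show Fin.last 2 = (2 : Fin 3) from rfl, ← hn2, real_inner_comm, hv, zero_smul, add_zero] at this
    simpa only [real_inner_comm] using this

/-- Against vectors orthogonal to a nearby normal, increments of a parallel frame are small. -/
theorem IsSmoothFrame.abs_inner_sub_le {n g : ℝ → E3} {a b : ℝ} {Y : Fin 2 → ℝ → E3}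
    (hY : IsSmoothFrame n g a b Y) (hn : IsPrimitiveOn n g a b) (i : Fin 2) {x y ε : ℝ}
    (hx : x ∈ Icc a b) (hy : y ∈ Icc a b) (hxy : x ≤ y) {w m : E3} (hw : inner ℝ w m = 0)
    (hm : ∀ s ∈ Icc x y, ‖n s - m‖ ≤ ε) :
    |inner ℝ w (Y i y - Y i x)| ≤ ‖w‖ * ε * ∫ s in x..y, ‖g s‖ := by
  have hi := (hY.isPrimitiveOn i).integrable_sub hx hy
  rw [(hY.isPrimitiveOn i).sub_eq hx hy]
  have h1 := (innerSL ℝ w).intervalIntegral_comp_comm hi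
  simp only [innerSL_apply_apply] at h1
  rw [← h1, ← Real.norm_eq_abs, ← intervalIntegral.integral_const_mul]
  refine intervalIntegral.norm_integral_le_of_norm_le hxy (.of_forall fun s hs => ?_)
    ((hn.integrable_sub hx hy).norm.const_mul _)
  have hs' : s ∈ Icc x y := ⟨hs.1.le, hs.2⟩
  have hYs : ‖Y i s‖ = 1 := (hY.orthonormal s ⟨hx.1.trans hs'.1, hs'.2.trans hy.2⟩).1 i
  have h2 : inner ℝ w (n s) = inner ℝ w (n s - m) := by rw [inner_sub_right, hw, sub_zero]
  rw [real_inner_smul_right, h2, norm_mul, norm_neg]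
  have h3 : ‖inner ℝ (Y i s) (g s)‖ ≤ ‖g s‖ := by
    simpa [hYs] using norm_inner_le_norm (𝕜 := ℝ) (Y i s) (g s)
  have h4 : ‖inner ℝ w (n s - m)‖ ≤ ‖w‖ * ε :=
    (norm_inner_le_norm (𝕜 := ℝ) w (n s - m)).trans
      (mul_le_mul_of_nonneg_left (hm s hs') (norm_nonneg _))
  rw [mul_comm]
  exact mul_le_mul h4 h3 (norm_nonneg _) ((norm_nonneg _).trans h4)

/-- The core estimate. The field with the constant coordinates `c i` equals `v` at `x` and the
transported vector at `a`; its norm is constant and its derivative is `-⟨field, g⟩ n`. -/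
theorem IsSmoothFrame.norm_sum_sub_le {n g : ℝ → E3} {a b : ℝ} {Y : Fin 2 → ℝ → E3}
    (hY : IsSmoothFrame n g a b Y) (hn : IsPrimitiveOn n g a b)
    (h1 : ∀ x ∈ Icc a b, ‖n x‖ = 1) {x : ℝ} (hx : x ∈ Icc a b) {v : E3}
    (hv : inner ℝ v (n x) = 0) :
    ‖∑ i, inner ℝ v (Y i x) • Y i a - v‖ ≤ ‖v‖ * ∫ s in a..x, ‖g s‖ := by
  have ha : a ∈ Icc a b := ⟨le_rfl, hx.1.trans hx.2⟩
  set c : Fin 2 → ℝ := fun i => inner ℝ v (Y i x) with hc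
  have hvx : v = ∑ i, c i • Y i x := hY.expansion x hx v hv
  have hnorm : ∀ s ∈ Icc a b, ‖∑ i, c i • Y i s‖ = ‖v‖ := by
    have key : ∀ s ∈ Icc a b, ‖∑ i, c i • Y i s‖ ^ 2 = ∑ i, c i * c i := fun s hs => by
      rw [← real_inner_self_eq_norm_sq, (hY.orthonormal s hs).inner_sum]
      simp
    intro s hs
    have := (key s hs).trans (key x hx).symm
    rw [← hvx] at this
    exact (sq_eq_sq₀ (norm_nonneg _) (norm_nonneg _)).1 this
  have hi : ∀ i, IntervalIntegrable (fun s => c i • ((-(inner ℝ (Y i s) (g s))) • n s)) volume a x :=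
    fun i => ((hY.isPrimitiveOn i).integrable_sub ha hx).smul (c i)
  have h2 : v - ∑ i, c i • Y i a =
      ∫ s in a..x, ∑ i, c i • ((-(inner ℝ (Y i s) (g s))) • n s) := by
    rw [intervalIntegral.integral_finsetSum fun i _ => hi i]
    conv_lhs => rw [hvx, ← Finset.sum_sub_distrib]
    refine Finset.sum_congr rfl fun i _ => ?_
    rw [intervalIntegral.integral_smul, ← (hY.isPrimitiveOn i).sub_eq ha hx, smul_sub]
  rw [norm_sub_rev, h2, ← intervalIntegral.integral_const_mul]
  refine intervalIntegral.norm_integral_le_of_norm_le hx.1 (.of_forall fun s hs => ?_)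
    ((hn.integrable_sub ha hx).norm.const_mul _)
  have hs' : s ∈ Icc a b := ⟨hs.1.le, hs.2.trans hx.2⟩
  have h3 : ∑ i, c i • ((-(inner ℝ (Y i s) (g s))) • n s) =
      (-(inner ℝ (∑ i, c i • Y i s) (g s))) • n s := by
    simp only [sum_inner, real_inner_smul_left, smul_smul, mul_neg, ← Finset.sum_smul,
      Finset.sum_neg_distrib]
  rw [h3, norm_smul, norm_neg, h1 s hs', mul_one, ← hnorm s hs']
  exact norm_inner_le_norm _ _

end FramedLoop

/-! ### Increments and difference quotients in the mean -/

/-- With `G` the primitive of `k`, the integral of `G (x + h) - G x` telescopes to that of `G` over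
the last strip of width `h` minus that over the first; use `0 ≤ G ≤ G b`. -/
theorem integral_increment_le {k : ℝ → ℝ} {a b h : ℝ} (hk : IntervalIntegrable k volume a b)
    (h0 : ∀ x, 0 ≤ k x) (hh : 0 < h) (hhb : h ≤ b - a) :
    IntegrableOn (fun x => ∫ t in x..x + h, k t) (Ioo a (b - h)) ∧
      ∫ x in Ioo a (b - h), ∫ t in x..x + h, k t ≤ h * ∫ t in a..b, k t := by
  have hab : a ≤ b := by linarith
  set G : ℝ → ℝ := fun x => ∫ t in a..x, k t with hG
  have hp : IsPrimitiveOn G k a b := ⟨hk, fun x _ => by simp [hG]⟩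
  have hGc := hp.continuousOn hab
  have hGi : ∀ {c d}, c ∈ Icc a b → d ∈ Icc a b → IntervalIntegrable G volume c d :=
    fun hc hd => (hGc.mono (uIcc_subset_Icc hc hd)).intervalIntegrable
  have hG0 : ∀ x ∈ Icc a b, 0 ≤ G x := fun x hx =>
    intervalIntegral.integral_nonneg hx.1 fun _ _ => h0 _
  have hGb : ∀ x ∈ Icc a b, G x ≤ G b := fun x hx => by
    have h1 := hp.sub_eq hx (right_mem_Icc.2 hab)
    have h2 : 0 ≤ ∫ t in x..b, k t := intervalIntegral.integral_nonneg hx.2 fun _ _ => h0 _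
    linarith
  have ma : a ∈ Icc a b := ⟨le_rfl, hab⟩
  have mb : b ∈ Icc a b := ⟨hab, le_rfl⟩
  have mah : a + h ∈ Icc a b := ⟨by linarith, by linarith⟩
  have mbh : b - h ∈ Icc a b := ⟨by linarith, by linarith⟩
  have hle : a ≤ b - h := by linarith
  have heq : ∀ x ∈ Ioo a (b - h), ∫ t in x..x + h, k t = G (x + h) - G x := fun x hx =>
    (hp.sub_eq ⟨hx.1.le, by linarith [hx.2]⟩ ⟨by linarith [hx.1], by linarith [hx.2]⟩).symm
  have hGs : IntervalIntegrable (fun x => G (x + h)) volume a (b - h) := by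
    simpa using (hGi mah mb).comp_add_right h
  have hsub := hGs.sub (hGi ma mbh)
  refine ⟨?_, ?_⟩
  · refine ((intervalIntegrable_iff_integrableOn_Ioo_of_le hle).1 hsub).congr_fun
      (fun x hx => (heq x hx).symm) measurableSet_Ioo
  · rw [setIntegral_congr_fun measurableSet_Ioo heq, ← integral_Ioc_eq_integral_Ioo,
      ← intervalIntegral.integral_of_le hle, intervalIntegral.integral_sub hGs (hGi ma mbh),
      intervalIntegral.integral_comp_add_right, sub_add_cancel]
    have e1 := intervalIntegral.integral_add_adjacent_intervals (hGi ma mah) (hGi mah mb)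
    have e2 := intervalIntegral.integral_add_adjacent_intervals (hGi ma mbh) (hGi mbh mb)
    have e3 : 0 ≤ ∫ x in a..a + h, G x := intervalIntegral.integral_nonneg (by linarith)
      fun x hx => hG0 x ⟨hx.1, hx.2.trans mah.2⟩
    have e4 : ∫ x in (b - h)..b, G x ≤ ∫ x in (b - h)..b, G b :=
      intervalIntegral.integral_mono_on (by linarith) (hGi mbh mb) intervalIntegrable_const
        fun x hx => hGb x ⟨mbh.1.trans hx.1, hx.2⟩
    rw [intervalIntegral.integral_const, smul_eq_mul, sub_sub_cancel] at e4
    linarith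

/-- A function whose difference quotients tend to zero in `L¹` is constant. -/
theorem exists_ae_eq_const_of_tendsto_diffQuot {u : ℝ → ℝ} {a b : ℝ} (hab : a < b)
    (hu : IntervalIntegrable u volume a b)
    (h : Tendsto (fun h : ℝ => ∫ x in Ioo a (b - h), |h⁻¹ * (u (x + h) - u x)|)
      (𝓝[>] 0) (𝓝 0)) : ∃ c, ∀ᵐ x, x ∈ Ioo a b → u x = c := by
  set U : ℝ → ℝ := fun x => ∫ t in a..x, u t with hU
  have hp : IsPrimitiveOn U u a b := ⟨hu, fun x _ => by simp [hU]⟩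
  have hL := hp.ae_hasDerivAt hab.le
  -- Up to sign, `∫ (u (x + t) - u x) / t` over `[c, d]` is the difference of the slopes of `U` at
  -- `c` and `d`. It tends to `u d - u c`, and to zero by `h`.
  have key : ∀ c ∈ Ioo a b, ∀ d ∈ Ioo a b, c < d → HasDerivAt U (u c) c → HasDerivAt U (u d) d →
      u d = u c := by
    intro c hc d hd hcd hUc hUd
    have hQ := ((hasDerivAt_iff_tendsto_slope_zero.1 hUd).sub
      (hasDerivAt_iff_tendsto_slope_zero.1 hUc)).mono_left
      (nhdsWithin_mono (0 : ℝ) fun x (hx : x ∈ Ioi (0 : ℝ)) => (mem_Ioi.1 hx).ne')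
    refine sub_eq_zero.1 (tendsto_nhds_unique hQ (squeeze_zero_norm' ?_ h))
    filter_upwards [Ioo_mem_nhdsGT (show (0 : ℝ) < b - d by linarith [hd.2])] with t ht
    have mc : c ∈ Icc a b := ⟨hc.1.le, hc.2.le⟩
    have md : d ∈ Icc a b := ⟨hd.1.le, hd.2.le⟩
    have mct : c + t ∈ Icc a b := ⟨by linarith [hc.1, ht.1], by linarith [ht.2]⟩
    have mdt : d + t ∈ Icc a b := ⟨by linarith [hd.1, ht.1], by linarith [ht.2]⟩
    have hle : a ≤ b - t := by linarith [ht.2, hd.1]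
    have ma : a ∈ Icc a b := ⟨le_rfl, hab.le⟩
    have mb : b ∈ Icc a b := ⟨hab.le, le_rfl⟩
    have hs1 : IntervalIntegrable (fun x => u (x + t)) volume c d := by
      simpa using (hp.integrable_sub mct mdt).comp_add_right t
    have hs2 : IntervalIntegrable (fun x => u (x + t)) volume a (b - t) := by
      simpa using (hp.integrable_sub (x := a + t) (y := b)
        ⟨by linarith [ht.1], by linarith⟩ mb).comp_add_right t
    have hs3 : IntervalIntegrable u volume a (b - t) :=
      hp.integrable_sub ma ⟨hle, by linarith [ht.1]⟩
    have e1 : t⁻¹ • (U (d + t) - U d) - t⁻¹ • (U (c + t) - U c) =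
        ∫ x in c..d, t⁻¹ * (u (x + t) - u x) := by
      rw [intervalIntegral.integral_const_mul,
        intervalIntegral.integral_sub hs1 (hp.integrable_sub mc md),
        intervalIntegral.integral_comp_add_right, ← hp.sub_eq mct mdt, ← hp.sub_eq mc md,
        smul_eq_mul, smul_eq_mul]
      ring
    rw [e1]
    refine (intervalIntegral.norm_integral_le_integral_norm hcd.le).trans ?_
    rw [intervalIntegral.integral_of_le hcd.le]
    refine setIntegral_mono_set ?_ (.of_forall fun _ => abs_nonneg _) ?_
    · exact (intervalIntegrable_iff_integrableOn_Ioo_of_le hle).1 ((hs2.sub hs3).const_mul t⁻¹).abs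
    · exact LE.le.eventuallyLE fun x hx =>
        ⟨hc.1.trans hx.1, by linarith [hx.2, ht.2]⟩
  obtain ⟨c, hcm, hUc⟩ : ∃ c ∈ Ioo a b, HasDerivAt U (u c) c := by
    have hne : (ae (volume.restrict (Ioo a b))).NeBot := by
      rw [ae_neBot, Ne, Measure.restrict_eq_zero]
      simp [hab]
    obtain ⟨c, hc⟩ := ((ae_restrict_iff' measurableSet_Ioo).2
      (hL.mono fun x hx hxm => And.intro hxm
        (hx (by rw [uIcc_of_le hab.le]; exact Ioo_subset_Icc_self hxm)))).exists
    exact ⟨c, hc⟩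
  refine ⟨u c, ?_⟩
  filter_upwards [hL] with x hx hxm
  have hUx := hx (by rw [uIcc_of_le hab.le]; exact Ioo_subset_Icc_self hxm)
  rcases lt_trichotomy x c with hlt | rfl | hlt
  · exact (key x hxm c hcm hlt hUx hUc).symm
  · rfl
  · exact key c hcm x hxm hlt hUc hUx

/-! ### Weakly parallel fields compared with classical frames -/

namespace FramedLoop

theorem continuous_tangentialPart : Continuous fun p : E3 × E3 => tangentialPart p.1 p.2 := by
  unfold tangentialPart
  fun_prop

theorem inner_tangentialPart_self {n : E3} (hn : ‖n‖ = 1) (v : E3) :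
    inner ℝ (tangentialPart n v) n = 0 := by
  rw [tangentialPart, inner_sub_left, real_inner_smul_left, real_inner_self_eq_norm_sq, hn]
  ring

theorem inner_tangentialPart_of_orthogonal {n y : E3} (hy : inner ℝ y n = 0) (v : E3) :
    inner ℝ (tangentialPart n v) y = inner ℝ v y := by
  rw [tangentialPart, inner_sub_left, real_inner_smul_left, real_inner_comm y n, hy]
  ring

theorem tangentialPart_smul (n : E3) (c : ℝ) (v : E3) :
    tangentialPart n (c • v) = c • tangentialPart n v := by
  rw [tangentialPart, tangentialPart, real_inner_smul_left, smul_sub, smul_smul]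

theorem norm_tangentialPart_sq {n : E3} (hn : ‖n‖ = 1) (v : E3) :
    ‖tangentialPart n v‖ ^ 2 = inner ℝ (tangentialPart n v) v := by
  rw [← real_inner_self_eq_norm_sq,
    inner_tangentialPart_of_orthogonal (inner_tangentialPart_self hn v) v, real_inner_comm]

/-- The pairing of `tangentialPart n v` with `v` is its squared norm, so one factor cancels. This
turns bounds tested against vectors orthogonal to `n` into norm bounds. -/
theorem norm_tangentialPart_le_of_abs_inner_le {n v : E3} {r : ℝ} (hn : ‖n‖ = 1) (hr : 0 ≤ r)
    (h : |inner ℝ (tangentialPart n v) v| ≤ ‖tangentialPart n v‖ * r) :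
    ‖tangentialPart n v‖ ≤ r := by
  have h1 := (norm_tangentialPart_sq hn v).le.trans ((le_abs_self _).trans h)
  rw [sq] at h1
  rcases (norm_nonneg (tangentialPart n v)).eq_or_lt with h0 | h0
  · rwa [← h0]
  · exact le_of_mul_le_mul_left h1 h0

theorem norm_tangentialPart_le {n : E3} (hn : ‖n‖ = 1) (v : E3) : ‖tangentialPart n v‖ ≤ ‖v‖ :=
  norm_tangentialPart_le_of_abs_inner_le hn (norm_nonneg v) (abs_real_inner_le_norm _ _)

theorem exists_uniform_modulus {n : ℝ → E3} {a b ε : ℝ} (hn : ContinuousOn n (Icc a b))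
    (hε : 0 < ε) : ∃ δ > 0, ∀ x ∈ Icc a b, ∀ y ∈ Icc a b, |x - y| < δ → ‖n x - n y‖ ≤ ε := by
  obtain ⟨δ, hδ, H⟩ := Metric.uniformContinuousOn_iff.1
    (isCompact_Icc.uniformContinuousOn_of_continuous hn) ε hε
  refine ⟨δ, hδ, fun x hx y hy hxy => ?_⟩
  simpa [dist_eq_norm] using (H x hx y hy hxy).le

theorem IsSmoothFrame.continuousOn {n g : ℝ → E3} {a b : ℝ} {Y : Fin 2 → ℝ → E3}
    (hY : IsSmoothFrame n g a b Y) (hab : a ≤ b) (i : Fin 2) : ContinuousOn (Y i) (Icc a b) :=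
  (hY.isPrimitiveOn i).continuousOn hab

/-- An increment of `Y` over `[x, x + h]` is an integral of multiples of `n s`, and `n s` is
uniformly close to `n x`; its part orthogonal to `n x` is therefore `o(1)` times `∫ ‖g‖` over `[x, x
+ h]`. -/
theorem IsSmoothFrame.isParallelFrame {N n g : ℝ → E3} {φ₀ : ℝ} {Y : Fin 2 → ℝ → E3}
    (hY : IsSmoothFrame n g φ₀ (φ₀ + 2 * Real.pi) Y)
    (hn : IsPrimitiveOn n g φ₀ (φ₀ + 2 * Real.pi))
    (h1 : ∀ x ∈ Icc φ₀ (φ₀ + 2 * Real.pi), ‖n x‖ = 1)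
    (hN : ∀ᵐ x, x ∈ Ioo φ₀ (φ₀ + 2 * Real.pi) → N x = n x) :
    IsParallelFrame N φ₀ Y := by
  have hab : φ₀ < φ₀ + 2 * Real.pi := by linarith [Real.two_pi_pos]
  set a := φ₀
  set b := φ₀ + 2 * Real.pi with hb
  have hnc := hn.continuousOn hab.le
  refine ⟨fun i => ⟨?_, ?_, ?_⟩, ?_⟩
  · refine memLp_top_of_bound (((hY.continuousOn hab.le i).mono
      Ioo_subset_Icc_self).aestronglyMeasurable measurableSet_Ioo) 1 ?_
    exact (ae_restrict_iff' measurableSet_Ioo).2 (.of_forall fun x hx =>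
      ((hY.orthonormal x (Ioo_subset_Icc_self hx)).1 i).le)
  · refine (ae_restrict_iff' measurableSet_Ioo).2 ?_
    filter_upwards [hN] with x hx hxm
    rw [hx hxm, hY.orthogonal i x (Ioo_subset_Icc_self hxm)]
  · set V := ∫ t in a..b, ‖g t‖ with hV
    have hV0 : 0 ≤ V := intervalIntegral.integral_nonneg hab.le fun _ _ => norm_nonneg _
    rw [Metric.tendsto_nhds]
    intro ε hε
    -- Integrated over `x`, the increments contribute `h * V`; the `+ 1` allows `V = 0`.
    obtain ⟨δ, hδ, hmod⟩ := exists_uniform_modulus hnc (show 0 < ε / (V + 1) by positivity)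
    filter_upwards [Ioo_mem_nhdsGT (lt_min hδ (sub_pos.2 hab))] with h hh
    have hh0 : 0 < h := hh.1
    have hhδ : h < δ := hh.2.trans_le (min_le_left _ _)
    have hhb : h < b - a := hh.2.trans_le (min_le_right _ _)
    obtain ⟨hint, hle⟩ := integral_increment_le hn.1.norm (fun _ => norm_nonneg _) hh0 hhb.le
    rw [dist_zero_right]
    have hbound : ‖∫ x in Ioo a (b - h), ‖tangentialPart (N x) (h⁻¹ • (Y i (x + h) - Y i x))‖‖ ≤
        ∫ x in Ioo a (b - h), h⁻¹ * (ε / (V + 1)) * ∫ t in x..x + h, ‖g t‖ := by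
      refine norm_integral_le_of_norm_le (hint.const_mul _) ?_
      refine (ae_restrict_iff' measurableSet_Ioo).2 ?_
      filter_upwards [hN] with x hx hxm
      have hxI : x ∈ Icc a b := ⟨hxm.1.le, by linarith [hxm.2]⟩
      have hxhI : x + h ∈ Icc a b := ⟨by linarith [hxm.1], by linarith [hxm.2]⟩
      have hn1 := h1 x hxI
      have hI0 : 0 ≤ ∫ t in x..x + h, ‖g t‖ :=
        intervalIntegral.integral_nonneg (by linarith) fun _ _ => norm_nonneg _
      rw [hx ⟨hxm.1, by linarith [hxm.2]⟩, norm_norm, tangentialPart_smul, norm_smul, norm_inv,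
        Real.norm_eq_abs, abs_of_pos hh0, mul_assoc]
      refine mul_le_mul_of_nonneg_left ?_ (by positivity)
      refine norm_tangentialPart_le_of_abs_inner_le hn1 (by positivity) ?_
      rw [← mul_assoc]
      refine hY.abs_inner_sub_le hn i hxI hxhI (by linarith) (inner_tangentialPart_self hn1 _)
        fun s hs => hmod s ⟨hxI.1.trans hs.1, hs.2.trans hxhI.2⟩ x hxI ?_
      rw [abs_of_nonneg (by linarith [hs.1])]
      linarith [hs.2]
    refine hbound.trans_lt ?_
    rw [integral_const_mul]
    calc h⁻¹ * (ε / (V + 1)) * ∫ x in Ioo a (b - h), ∫ t in x..x + h, ‖g t‖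
        ≤ h⁻¹ * (ε / (V + 1)) * (h * V) := mul_le_mul_of_nonneg_left hle (by positivity)
      _ = ε * (V / (V + 1)) := by field_simp
      _ < ε * 1 := by
        refine mul_lt_mul_of_pos_left ?_ hε
        rw [div_lt_one (by positivity)]
        linarith
      _ = ε := mul_one ε
  · exact (ae_restrict_iff' measurableSet_Ioo).2 (.of_forall fun x hx =>
      hY.orthonormal x (Ioo_subset_Icc_self hx))

/-- A parallel field has constant coordinates in an absolutely continuous parallel frame. -/
theorem IsParallelField.exists_ae_inner_eq_const {N n g X : ℝ → E3} {φ₀ : ℝ} {Y : Fin 2 → ℝ → E3}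
    (hX : IsParallelField N φ₀ X)
    (hY : IsSmoothFrame n g φ₀ (φ₀ + 2 * Real.pi) Y)
    (hn : IsPrimitiveOn n g φ₀ (φ₀ + 2 * Real.pi))
    (h1 : ∀ x ∈ Icc φ₀ (φ₀ + 2 * Real.pi), ‖n x‖ = 1)
    (hN : ∀ᵐ x, x ∈ Ioo φ₀ (φ₀ + 2 * Real.pi) → N x = n x) (i : Fin 2) :
    ∃ c : ℝ, ∀ᵐ x, x ∈ Ioo φ₀ (φ₀ + 2 * Real.pi) → inner ℝ (X x) (Y i x) = c := by
  have hab : φ₀ < φ₀ + 2 * Real.pi := by linarith [Real.two_pi_pos]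
  have hXp := hX.parallel
  have hXb := hX.bounded
  have hXo := (ae_restrict_iff' measurableSet_Ioo).1 hX.orthogonal
  generalize φ₀ + 2 * Real.pi = b at *
  set a := φ₀
  have hnc := hn.continuousOn hab.le
  have hYc := hY.continuousOn hab.le i
  obtain ⟨C, hC0, hC⟩ : ∃ C : ℝ, 0 ≤ C ∧ ∀ᵐ x, x ∈ Ioo a b → ‖X x‖ ≤ C := by
    refine ⟨(eLpNorm X ⊤ (volume.restrict (Ioo a b))).toReal, ENNReal.toReal_nonneg,
      (ae_restrict_iff' measurableSet_Ioo).1 ?_⟩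
    filter_upwards [ae_le_eLpNormEssSup (f := X) (μ := volume.restrict (Ioo a b))] with x hx
    rw [← eLpNorm_exponent_top] at hx
    rw [← toReal_enorm]
    exact ENNReal.toReal_mono hXb.eLpNorm_ne_top hx
  have hXi : IntervalIntegrable X volume a b :=
    (intervalIntegrable_iff_integrableOn_Ioo_of_le hab.le).2 (hXb.integrable le_top)
  have hui : IntervalIntegrable (fun x => inner ℝ (X x) (Y i x)) volume a b := by
    rw [intervalIntegrable_iff_integrableOn_Ioo_of_le hab.le]
    refine Integrable.mono' (g := fun _ => C) (integrable_const C) (hXb.1.inner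
      ((hYc.mono Ioo_subset_Icc_self).aestronglyMeasurable measurableSet_Ioo)) ?_
    refine (ae_restrict_iff' measurableSet_Ioo).2 ?_
    filter_upwards [hC] with x hx hxm
    have := norm_inner_le_norm (𝕜 := ℝ) (X x) (Y i x)
    rw [(hY.orthonormal x (Ioo_subset_Icc_self hxm)).1 i, mul_one] at this
    exact this.trans (hx hxm)
  refine exists_ae_eq_const_of_tendsto_diffQuot hab hui ?_
  set V := ∫ t in a..b, ‖g t‖ with hV
  have hV0 : 0 ≤ V := intervalIntegral.integral_nonneg hab.le fun _ _ => norm_nonneg _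
  rw [Metric.tendsto_nhds]
  intro ε hε
  obtain ⟨δ, hδ, hmod⟩ := exists_uniform_modulus hnc
    (show 0 < ε / (2 * (C * V + 1)) by positivity)
  filter_upwards [Ioo_mem_nhdsGT (lt_min hδ (sub_pos.2 hab)),
    (Metric.tendsto_nhds.1 hXp) (ε / 2) (by positivity)] with h hh hq
  have hh0 : 0 < h := hh.1
  have hhδ : h < δ := hh.2.trans_le (min_le_left _ _)
  have hhb : h < b - a := hh.2.trans_le (min_le_right _ _)
  have hle' : a ≤ b - h := by linarith
  obtain ⟨hint, hle⟩ := integral_increment_le hn.1.norm (fun _ => norm_nonneg _) hh0 hhb.le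
  have hshift : ∀ {P : ℝ → Prop}, (∀ᵐ x, x ∈ Ioo a b → P x) →
      ∀ᵐ x, x + h ∈ Ioo a b → P (x + h) := fun hP =>
    (measurePreserving_add_right volume h).quasiMeasurePreserving.ae hP
  have hsub : Ioo a (b - h) ⊆ Ioo a b := Ioo_subset_Ioo_right (by linarith)
  have hvi : IntegrableOn (fun x => h⁻¹ • (X (x + h) - X x)) (Ioo a (b - h)) := by
    have hs1 : IntervalIntegrable (fun x => X (x + h)) volume a (b - h) := by
      have : IntervalIntegrable X volume (a + h) b := hXi.mono_set (by
        rw [uIcc_of_le hab.le, uIcc_of_le (by linarith)]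
        exact Icc_subset_Icc_left (by linarith))
      simpa using this.comp_add_right h
    have hs2 : IntervalIntegrable X volume a (b - h) := hXi.mono_set (by
      rw [uIcc_of_le hab.le, uIcc_of_le hle']
      exact Icc_subset_Icc_right (by linarith))
    exact (((intervalIntegrable_iff_integrableOn_Ioo_of_le hle').1 hs1).sub
      ((intervalIntegrable_iff_integrableOn_Ioo_of_le hle').1 hs2)).smul h⁻¹
  have hNr : ∀ᵐ x ∂(volume.restrict (Ioo a (b - h))), N x = n x := by
    refine (ae_restrict_iff' measurableSet_Ioo).2 ?_
    filter_upwards [hN] with x hx hxm using hx (hsub hxm)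
  have hti : IntegrableOn (fun x => ‖tangentialPart (N x) (h⁻¹ • (X (x + h) - X x))‖)
      (Ioo a (b - h)) := by
    have hNm : AEStronglyMeasurable N (volume.restrict (Ioo a (b - h))) :=
      ((hnc.mono (hsub.trans Ioo_subset_Icc_self)).aestronglyMeasurable measurableSet_Ioo).congr
        (hNr.mono fun _ hx => hx.symm)
    have hm := continuous_tangentialPart.comp_aestronglyMeasurable (hNm.prodMk hvi.1)
    refine Integrable.mono' hvi.norm hm.norm ?_
    filter_upwards [hNr, ae_restrict_mem measurableSet_Ioo] with x hx hxm
    rw [norm_norm]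
    exact norm_tangentialPart_le (by rw [hx, h1 x (Ioo_subset_Icc_self (hsub hxm))]) _
  have hbound : ‖∫ x in Ioo a (b - h),
      |h⁻¹ * (inner ℝ (X (x + h)) (Y i (x + h)) - inner ℝ (X x) (Y i x))|‖ ≤
      ∫ x in Ioo a (b - h), (‖tangentialPart (N x) (h⁻¹ • (X (x + h) - X x))‖ +
        h⁻¹ * (C * (ε / (2 * (C * V + 1)))) * ∫ t in x..x + h, ‖g t‖) := by
    refine norm_integral_le_of_norm_le (hti.add (hint.const_mul _)) ?_
    refine (ae_restrict_iff' measurableSet_Ioo).2 ?_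
    filter_upwards [hN, hshift hN, hshift hC, hshift hXo] with x hx hxh hCx hox hxm
    have hxI : x ∈ Icc a b := Ioo_subset_Icc_self (hsub hxm)
    have hxh' : x + h ∈ Ioo a b := ⟨by linarith [hxm.1], by linarith [hxm.2]⟩
    have hxhI : x + h ∈ Icc a b := Ioo_subset_Icc_self hxh'
    have ho := hox hxh'
    rw [hxh hxh'] at ho
    have hI0 : 0 ≤ ∫ t in x..x + h, ‖g t‖ :=
      intervalIntegral.integral_nonneg (by linarith) fun _ _ => norm_nonneg _
    -- Discrete product rule. Projecting is free in the first term because `Y i x ⊥ n x`; that term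
    -- is controlled by the parallel condition.
    have e1 : h⁻¹ * (inner ℝ (X (x + h)) (Y i (x + h)) - inner ℝ (X x) (Y i x)) =
        inner ℝ (tangentialPart (n x) (h⁻¹ • (X (x + h) - X x))) (Y i x) +
          h⁻¹ * inner ℝ (X (x + h)) (Y i (x + h) - Y i x) := by
      rw [inner_tangentialPart_of_orthogonal (hY.orthogonal i x hxI), real_inner_smul_left,
        inner_sub_left, inner_sub_right]
      ring
    have e2 := norm_inner_le_norm (𝕜 := ℝ) (tangentialPart (n x) (h⁻¹ • (X (x + h) - X x))) (Y i x)
    rw [(hY.orthonormal x hxI).1 i, mul_one] at e2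
    have e3 : |inner ℝ (X (x + h)) (Y i (x + h) - Y i x)| ≤
        ‖X (x + h)‖ * (ε / (2 * (C * V + 1))) * ∫ t in x..x + h, ‖g t‖ := by
      -- The tested vector is `X (x + h)`, so the reference normal is `n (x + h)`, not `n x`.
      refine hY.abs_inner_sub_le hn i hxI hxhI (by linarith) ho
        fun s hs => hmod s ⟨hxI.1.trans hs.1, hs.2.trans hxhI.2⟩ _ hxhI ?_
      rw [abs_sub_comm, abs_of_nonneg (by linarith [hs.2])]
      linarith [hs.1]
    have e4 : ‖X (x + h)‖ * (ε / (2 * (C * V + 1))) * ∫ t in x..x + h, ‖g t‖ ≤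
        C * (ε / (2 * (C * V + 1))) * ∫ t in x..x + h, ‖g t‖ := by
      have := hCx hxh'
      gcongr
    rw [hx (hsub hxm), Real.norm_eq_abs, abs_abs, e1, mul_assoc]
    refine (abs_add_le _ _).trans (add_le_add e2 ?_)
    rw [abs_mul, abs_of_pos (inv_pos.2 hh0)]
    exact mul_le_mul_of_nonneg_left (e3.trans e4) (by positivity)
  rw [dist_zero_right] at hq ⊢
  refine hbound.trans_lt ?_
  rw [integral_add hti (hint.const_mul _), integral_const_mul]
  have e5 : h⁻¹ * (C * (ε / (2 * (C * V + 1)))) * ∫ x in Ioo a (b - h), ∫ t in x..x + h, ‖g t‖ ≤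
      ε / 2 := by
    calc _ ≤ h⁻¹ * (C * (ε / (2 * (C * V + 1)))) * (h * V) :=
          mul_le_mul_of_nonneg_left hle (by positivity)
      _ = ε / 2 * (C * V / (C * V + 1)) := by field_simp
      _ ≤ ε / 2 * 1 := by
        refine mul_le_mul_of_nonneg_left ?_ (by positivity)
        rw [div_le_one (by positivity)]
        linarith
      _ = ε / 2 := mul_one _
  have e6 := (le_abs_self _).trans_lt hq
  linarith

/-- The constant `‖e - e'‖` is at most the sum of the two averages, which tends to zero. -/
theorem HasRightValue.unique {X : ℝ → E3} {φ₀ r : ℝ} (hr : φ₀ < r)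
    (hX : IntegrableOn X (Ioo φ₀ r)) {e e' : E3}
    (h : HasRightValue X φ₀ e) (h' : HasRightValue X φ₀ e') : e = e' := by
  have hs := h.add h'
  rw [add_zero] at hs
  have hle : ∀ᶠ ε : ℝ in 𝓝[>] 0, ‖e - e'‖ ≤ ε⁻¹ * (∫ x in Ioo φ₀ (φ₀ + ε), ‖X x - e‖) +
      ε⁻¹ * ∫ x in Ioo φ₀ (φ₀ + ε), ‖X x - e'‖ := by
    filter_upwards [Ioo_mem_nhdsGT (sub_pos.2 hr)] with ε hε
    have hsub : Ioo φ₀ (φ₀ + ε) ⊆ Ioo φ₀ r := Ioo_subset_Ioo_right (by linarith [hε.2])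
    have hi : ∀ v : E3, IntegrableOn (fun x => ‖X x - v‖) (Ioo φ₀ (φ₀ + ε)) := fun v =>
      ((hX.mono_set hsub).sub (integrable_const v)).norm
    rw [← mul_add, ← integral_add (hi e) (hi e')]
    have h1 : ∫ x in Ioo φ₀ (φ₀ + ε), ‖e - e'‖ ≤
        ∫ x in Ioo φ₀ (φ₀ + ε), (‖X x - e‖ + ‖X x - e'‖) :=
      integral_mono (integrable_const _) ((hi e).add (hi e')) fun x => by
        have := norm_sub_le (X x - e') (X x - e)
        rw [sub_sub_sub_cancel_left] at this
        linarith
    rw [setIntegral_const, smul_eq_mul] at h1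
    have h2 : volume.real (Ioo φ₀ (φ₀ + ε)) = ε := by
      rw [Real.volume_real_Ioo_of_le (by linarith [hε.1])]
      ring
    rw [h2] at h1
    rw [inv_mul_eq_div, le_div_iff₀ hε.1, mul_comm]
    exact h1
  have := ge_of_tendsto hs hle
  exact sub_eq_zero.1 (norm_le_zero_iff.1 this)

theorem hasRightValue_of_continuousOn {X : ℝ → E3} {φ₀ r : ℝ} (hr : φ₀ < r)
    (hX : ContinuousOn X (Icc φ₀ r)) : HasRightValue X φ₀ (X φ₀) := by
  unfold HasRightValue
  rw [Metric.tendsto_nhds]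
  intro ε hε
  obtain ⟨δ, hδ, hmod⟩ := exists_uniform_modulus hX (half_pos hε)
  filter_upwards [Ioo_mem_nhdsGT (lt_min hδ (sub_pos.2 hr))] with h hh
  have hh0 : 0 < h := hh.1
  have hhδ : h < δ := hh.2.trans_le (min_le_left _ _)
  have hhb : h < r - φ₀ := hh.2.trans_le (min_le_right _ _)
  rw [dist_zero_right, norm_mul, norm_inv, Real.norm_eq_abs, abs_of_pos hh0]
  have h1 : ‖∫ x in Ioo φ₀ (φ₀ + h), ‖X x - X φ₀‖‖ ≤ ε / 2 * volume.real (Ioo φ₀ (φ₀ + h)) := by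
    refine norm_setIntegral_le_of_norm_le_const measure_Ioo_lt_top fun x hx => ?_
    rw [norm_norm]
    refine hmod x ⟨hx.1.le, by linarith [hx.2]⟩ _ ⟨le_rfl, hr.le⟩ ?_
    rw [abs_of_pos (sub_pos.2 hx.1)]
    linarith [hx.2]
  rw [Real.volume_real_Ioo_of_le (by linarith), add_sub_cancel_left] at h1
  calc _ ≤ h⁻¹ * (ε / 2 * h) := mul_le_mul_of_nonneg_left h1 (by positivity)
    _ = ε / 2 := by field_simp
    _ < ε := half_lt_self hε

theorem HasRightValue.congr_ae {X X' : ℝ → E3} {φ₀ r : ℝ} (hr : φ₀ < r) {e : E3}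
    (h : HasRightValue X φ₀ e) (hXX : ∀ᵐ x, x ∈ Ioo φ₀ r → X x = X' x) :
    HasRightValue X' φ₀ e := by
  refine Tendsto.congr' ?_ h
  filter_upwards [Ioo_mem_nhdsGT (sub_pos.2 hr)] with ε hε
  congr 1
  refine setIntegral_congr_ae measurableSet_Ioo ?_
  filter_upwards [hXX] with x hx hxm
  rw [hx ⟨hxm.1, by linarith [hxm.2, hε.2]⟩]

/-- Parallel frames differ by a constant rotation, so all of them define the same transport. -/
theorem IsParallelFrame.ae_transportToBase_eq {N n g : ℝ → E3} {φ₀ : ℝ}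
    {E Y : Fin 2 → ℝ → E3} {e : Fin 2 → E3} (hE : IsParallelFrame N φ₀ E)
    (he : ∀ i, HasRightValue (E i) φ₀ (e i))
    (hY : IsSmoothFrame n g φ₀ (φ₀ + 2 * Real.pi) Y)
    (hn : IsPrimitiveOn n g φ₀ (φ₀ + 2 * Real.pi))
    (h1 : ∀ x ∈ Icc φ₀ (φ₀ + 2 * Real.pi), ‖n x‖ = 1)
    (hN : ∀ᵐ x, x ∈ Ioo φ₀ (φ₀ + 2 * Real.pi) → N x = n x) :
    ∀ᵐ x, x ∈ Ioo φ₀ (φ₀ + 2 * Real.pi) → ∀ v,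
      transportToBase E e x v = transportToBase Y (fun i => Y i φ₀) x v := by
  have hab : φ₀ < φ₀ + 2 * Real.pi := by linarith [Real.two_pi_pos]
  choose c hc using fun i j => (hE.isParallel i).exists_ae_inner_eq_const hY hn h1 hN j
  have hEY : ∀ᵐ x, x ∈ Ioo φ₀ (φ₀ + 2 * Real.pi) → ∀ i, E i x = ∑ j, c i j • Y j x := by
    filter_upwards [ae_all_iff.2 fun i => ae_all_iff.2 fun j => hc i j, hN,
      ae_all_iff.2 fun i => (ae_restrict_iff' measurableSet_Ioo).1 (hE.isParallel i).orthogonal]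
      with x hx hNx hox hxm i
    have h2 := hox i hxm
    rw [hNx hxm] at h2
    refine (hY.expansion x (Ioo_subset_Icc_self hxm) _ h2).trans ?_
    simp only [hx i _ hxm]
  -- The base values change by the same matrix `c`, by uniqueness of right values and continuity of
  -- `Y`.
  have hee : ∀ i, e i = ∑ j, c i j • Y j φ₀ := by
    intro i
    have hcont : ContinuousOn (fun x => ∑ j, c i j • Y j x) (Icc φ₀ (φ₀ + 2 * Real.pi)) :=
      continuousOn_finsetSum _ fun j _ => (hY.continuousOn hab.le j).const_smul (c i j)
    refine HasRightValue.unique hab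
      ((hcont.integrableOn_compact isCompact_Icc).mono_set Ioo_subset_Icc_self)
      ((he i).congr_ae hab ?_) (hasRightValue_of_continuousOn hab hcont)
    filter_upwards [hEY] with x hx hxm using hx hxm i
  have hort : ∀ j k, ∑ i, c i j * c i k = if j = k then 1 else 0 := by
    have hne : (ae (volume.restrict (Ioo φ₀ (φ₀ + 2 * Real.pi)))).NeBot := by
      rw [ae_neBot, Ne, Measure.restrict_eq_zero]
      simp [Real.pi_pos]
    obtain ⟨x, hx, hxo, hxm⟩ := (((ae_restrict_iff' measurableSet_Ioo).2 hEY).and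
      (hE.orthonormal.and (ae_restrict_mem measurableSet_Ioo))).exists
    have hrow : ∀ i j, ∑ k, c i k * c j k = if i = j then 1 else 0 := fun i j => by
      rw [← orthonormal_iff_ite.1 hxo i j, hx i, hx j,
        (hY.orthonormal x (Ioo_subset_Icc_self hxm)).inner_sum]
      simp
    have hM : (Matrix.of c) * (Matrix.of c).transpose = 1 := by
      ext i j
      simpa [Matrix.mul_apply, Matrix.one_apply] using hrow i j
    -- Orthonormality of the frames at a single point gives orthonormal rows; the cancellation below
    -- needs orthonormal columns, and `c` is square.
    have hM' := mul_eq_one_comm.1 hM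
    intro j k
    have := congrFun (congrFun hM' j) k
    simpa [Matrix.mul_apply, Matrix.one_apply] using this
  filter_upwards [hEY] with x hx hxm v
  simp only [transportToBase, hx hxm, hee, inner_sum, real_inner_smul_right,
    Finset.smul_sum, smul_smul]
  rw [Finset.sum_comm]
  refine Finset.sum_congr rfl fun j _ => ?_
  rw [← Finset.sum_smul]
  congr 1
  calc ∑ i, (∑ k, c i k * inner ℝ v (Y k x)) * c i j
      = ∑ k, (∑ i, c i k * c i j) * inner ℝ v (Y k x) := by
        simp only [Finset.sum_mul]
        rw [Finset.sum_comm]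
        exact Finset.sum_congr rfl fun k _ => Finset.sum_congr rfl fun i _ => by ring
    _ = inner ℝ v (Y j x) := by simp [hort]

/-! ### The Burgers vector: existence, uniqueness and the bound -/

theorem HasWeakDeriv.exists_unit_isPrimitiveOn {N dN : ℝ → E3} (h : HasWeakDeriv N dN)
    (h1 : ∀ᵐ x, ‖N x‖ = 1) (a : ℝ) :
    ∃ n : ℝ → E3, IsPrimitiveOn n dN a (a + 2 * Real.pi) ∧
      (∀ x ∈ Icc a (a + 2 * Real.pi), ‖n x‖ = 1) ∧
      ∀ᵐ x, x ∈ Ioo a (a + 2 * Real.pi) → N x = n x := by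
  obtain ⟨n, hn, hN⟩ := h.exists_isPrimitiveOn a
  have hab : a < a + 2 * Real.pi := by linarith [Real.two_pi_pos]
  have hc : ContinuousOn (fun x => ‖n x‖) (Icc a (a + 2 * Real.pi)) := (hn.continuousOn hab.le).norm
  have hae : (fun x => ‖n x‖) =ᵐ[volume.restrict (Icc a (a + 2 * Real.pi))] fun _ => 1 := by
    rw [← restrict_Ioo_eq_restrict_Icc]
    refine (ae_restrict_iff' measurableSet_Ioo).2 ?_
    filter_upwards [hN, h1] with x hx hx1 hxm
    rw [← hx hxm, hx1]
  exact ⟨n, hn, fun x hx => Measure.eqOn_Icc_of_ae_eq volume hab.ne hae hc continuousOn_const hx, hN⟩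

/-- One explicit integral characterizes all Burgers vectors, which settles existence and uniqueness
together. -/
theorem IsHalfFramedLoop.exists_frame {γ dγ N dN : ℝ → E3} (hloop : IsHalfFramedLoop γ dγ N)
    (hN : HasWeakDeriv N dN) (φ₀ : ℝ) :
    ∃ (n : ℝ → E3) (Y : Fin 2 → ℝ → E3), IsPrimitiveOn n dN φ₀ (φ₀ + 2 * Real.pi) ∧
      (∀ x ∈ Icc φ₀ (φ₀ + 2 * Real.pi), ‖n x‖ = 1) ∧
      (∀ᵐ x, x ∈ Ioo φ₀ (φ₀ + 2 * Real.pi) → N x = n x) ∧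
      IsSmoothFrame n dN φ₀ (φ₀ + 2 * Real.pi) Y ∧
      ∀ B, IsBurgersVector dγ N φ₀ B ↔
        B = ∫ φ in Ioo φ₀ (φ₀ + 2 * Real.pi), transportToBase Y (fun i => Y i φ₀) φ (dγ φ) := by
  have hab : φ₀ < φ₀ + 2 * Real.pi := by linarith [Real.two_pi_pos]
  obtain ⟨n, hn, h1, hNn⟩ := hN.exists_unit_isPrimitiveOn hloop.normal_unit φ₀
  obtain ⟨Y, hY⟩ := exists_isSmoothFrame hab.le hn h1
  refine ⟨n, Y, hn, h1, hNn, hY, fun B => ⟨?_, fun hB => ?_⟩⟩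
  · rintro ⟨E, e, hE, he, rfl⟩
    refine setIntegral_congr_ae measurableSet_Ioo ?_
    filter_upwards [hE.ae_transportToBase_eq he hY hn h1 hNn] with x hx hxm using hx hxm _
  · exact ⟨Y, fun i => Y i φ₀, hY.isParallelFrame hn h1 hNn,
      fun i => hasRightValue_of_continuousOn hab (hY.continuousOn hab.le i), hB⟩

theorem integral_norm_eq_of_periodic {g : ℝ → E3} (hg : Function.Periodic g (2 * Real.pi))
    (a : ℝ) : ∫ x in a..a + 2 * Real.pi, ‖g x‖ = ∫ x in Ioc 0 (2 * Real.pi), ‖g x‖ := by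
  have hp : Function.Periodic (fun x => ‖g x‖) (2 * Real.pi) := fun x => by simp only [hg x]
  rw [hp.intervalIntegral_add_eq a 0, zero_add, intervalIntegral.integral_of_le Real.two_pi_pos.le]

theorem IsHalfFramedLoop.norm_burgersVector_le {γ dγ N dN : ℝ → E3}
    (hloop : IsHalfFramedLoop γ dγ N) (hN : HasWeakDeriv N dN) {φ₀ : ℝ} {B : E3}
    (hB : IsBurgersVector dγ N φ₀ B) :
    ‖B‖ ≤ (∫ x in Ioc 0 (2 * Real.pi), ‖dN x‖) * loopLength dγ := by
  have hab : φ₀ < φ₀ + 2 * Real.pi := by linarith [Real.two_pi_pos]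
  obtain ⟨n, Y, hn, h1, hNn, hY, hBY⟩ := hloop.exists_frame hN φ₀
  have hdi := hloop.hasWeakDeriv.intervalIntegrable_deriv φ₀ (φ₀ + 2 * Real.pi)
  have hd0 := hloop.hasWeakDeriv.integral_deriv_eq_zero φ₀
  have hT : IntervalIntegrable (fun φ => transportToBase Y (fun i => Y i φ₀) φ (dγ φ)) volume
      φ₀ (φ₀ + 2 * Real.pi) := by
    have hi := (intervalIntegrable_iff_integrableOn_Ioo_of_le hab.le).1 hdi
    rw [intervalIntegrable_iff_integrableOn_Ioo_of_le hab.le]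
    refine integrable_finsetSum _ fun i _ => Integrable.smul_const ?_ _
    refine Integrable.mono' hi.norm (hi.1.inner (((hY.continuousOn hab.le i).mono
      Ioo_subset_Icc_self).aestronglyMeasurable measurableSet_Ioo)) ?_
    refine (ae_restrict_iff' measurableSet_Ioo).2 (.of_forall fun x hx => ?_)
    have := norm_inner_le_norm (𝕜 := ℝ) (dγ x) (Y i x)
    rwa [(hY.orthonormal x (Ioo_subset_Icc_self hx)).1 i, mul_one] at this
  rw [hBY] at hB
  -- Subtracting `dγ` is free because the loop closes.
  have hB' : B = ∫ φ in φ₀..φ₀ + 2 * Real.pi,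
      (transportToBase Y (fun i => Y i φ₀) φ (dγ φ) - dγ φ) := by
    rw [intervalIntegral.integral_sub hT hdi, hd0, sub_zero, hB,
      intervalIntegral.integral_of_le hab.le, integral_Ioc_eq_integral_Ioo]
  have hV := integral_norm_eq_of_periodic hN.periodic_deriv φ₀
  have hL := integral_norm_eq_of_periodic hloop.hasWeakDeriv.periodic_deriv φ₀
  rw [hB', loopLength, ← hV, ← hL, ← intervalIntegral.integral_const_mul]
  refine intervalIntegral.norm_integral_le_of_norm_le hab.le ?_ (hdi.norm.const_mul _)
  have hne : ∀ᵐ x : ℝ, x ≠ φ₀ + 2 * Real.pi := by simp [ae_iff, measure_singleton]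
  filter_upwards [hNn, hloop.orthogonal, hne] with x hx ho hxb hxm
  have hxI : x ∈ Ioo φ₀ (φ₀ + 2 * Real.pi) := ⟨hxm.1, lt_of_le_of_ne hxm.2 hxb⟩
  have hxI' := Ioo_subset_Icc_self hxI
  rw [hx hxI] at ho
  refine (hY.norm_sum_sub_le hn h1 hxI' ho).trans ?_
  rw [mul_comm]
  refine mul_le_mul_of_nonneg_right ?_ (norm_nonneg _)
  have hm := right_mem_Icc.2 hab.le
  have h2 := intervalIntegral.integral_add_adjacent_intervals
    (hn.integrable_sub (left_mem_Icc.2 hab.le) hxI').norm (hn.integrable_sub hxI' hm).norm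
  have h3 : 0 ≤ ∫ s in x..φ₀ + 2 * Real.pi, ‖dN s‖ :=
    intervalIntegral.integral_nonneg hxI'.2 fun _ _ => norm_nonneg _
  linarith

/-- The speed is bounded away from zero, so it cancels. -/
theorem IsHalfFramedLoop.lintegral_variation_eq {γ dγ N dN : ℝ → E3}
    (hloop : IsHalfFramedLoop γ dγ N) (hN : HasWeakDeriv N dN) :
    ∫⁻ x in Ioc 0 (2 * Real.pi), ‖‖dγ x‖⁻¹ • dN x‖ₑ * ‖dγ x‖ₑ =
      ENNReal.ofReal (∫ x in Ioc 0 (2 * Real.pi), ‖dN x‖) := by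
  rw [ofReal_integral_norm_eq_lintegral_enorm hN.integrable_deriv]
  obtain ⟨c, C, hc, hcC⟩ := hloop.immersion
  refine lintegral_congr_ae (ae_restrict_of_ae ?_)
  filter_upwards [hcC] with x hx
  have h0 : ‖dγ x‖ ≠ 0 := (hc.trans_le hx.1).ne'
  rw [← enorm_norm (dγ x), mul_comm, ← enorm_smul, smul_smul, mul_inv_cancel₀ h0, one_smul]

end FramedLoop

theorem mainTheorem3 (γ dγ N : ℝ → FramedLoop.E3)
    (hloop : FramedLoop.IsHalfFramedLoop γ dγ N) (φ₀ : ℝ) :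
    (FramedLoop.normalVariation dγ N ≠ ⊤ → ∃! B, FramedLoop.IsBurgersVector dγ N φ₀ B) ∧
      ∀ B, FramedLoop.IsBurgersVector dγ N φ₀ B →
        ENNReal.ofReal (‖B‖ / FramedLoop.loopLength dγ) ≤ FramedLoop.normalVariation dγ N := by
  -- The infimum is bounded below derivative by derivative; with no weak derivative it is `⊤`, so
  -- that case of the inequality is vacuous.
  refine ⟨fun hfin => ?_, fun B hB => le_iInf₂ fun dN hN => ?_⟩
  · obtain ⟨dN, hN⟩ : ∃ dN, FramedLoop.HasWeakDeriv N dN := by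
      by_contra! hno
      exact hfin (by simp [FramedLoop.normalVariation, hno])
    obtain ⟨n, Y, _, _, _, _, hBY⟩ := hloop.exists_frame hN φ₀
    exact ⟨_, (hBY _).2 rfl, fun B hB => (hBY B).1 hB⟩
  · rw [hloop.lintegral_variation_eq hN]
    exact ENNReal.ofReal_le_ofReal (div_le_of_le_mul₀
      (integral_nonneg fun _ => norm_nonneg _) (integral_nonneg fun _ => norm_nonneg _)
      (hloop.norm_burgersVector_le hN hB))
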